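/- Let $\omega=e^{2\pi i/3}$ and let the Mitchell group $G_{34}\subset GL_6(\mathbb C)$ be the group generated by the (unitary, order two) reflections across the hyperplanes $x_i-x_j=0$ ($i\ne j$), $x_1-\omega x_2=0$ and $x_1+x_2+x_3+x_4+x_5+x_6=0$ of $\mathbb C^6$. For a sequence $\mathbf e=(e_1,\ldots,e_r)$ of positive integers, let $m_{\mathbf e}$ be the monomial symmetric polynomial in $x_1,\ldots,x_6$, i.e. the sum of all distinct monomials obtained from $x_1^{e_1}\cdots x_r^{e_r}$ by permuting the variables, and let $(\mathbf e)=(e_1+\cdots+e_r)!/(e_1!\cdots e_r!)$. For $k\ge1$ put $$f_{6k}=\bigl(1+(-1)^k\,27^{k-1}\cdot 5\bigr)m_{(6k)}+\sum_{s=1}^k\binom{6k}{3s}\bigl(1+(-1)^{k+s}27^{k-1}\bigr)m_{(6k-3s,\,3s)}+\sum_{\mathbf e}(\mathbf e)\,m_{\mathbf e},$$ where $\mathbf e$ ranges over all partitions $(e_1,\ldots,e_r)$ of $6k$ with $3\le r\le 6$ such that $e_i\equiv e_j \pmod 3$ for all $i,j$, and $e_i\equiv0\pmod 3$ if $r<6$.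 (1) The polynomials $f_6,f_{12},f_{18},f_{24},f_{30},f_{42}$ are algebraically independent over $\mathbb C$ and generate the invariant ring $\mathbb C[x_1,\ldots,x_6]^{G_{34}}$ as a $\mathbb C$-algebra; that is, $$\mathbb C[x_1,\ldots,x_6]^{G_{34}}=\mathbb C[f_6,f_{12},f_{18},f_{24},f_{30},f_{42}]$$ is a polynomial algebra on these generators. (2) Let $V\subset\mathbb C^6$ be the set of all vectors with $\omega^a$ in one position, $-\omega^b$ in another position and $0$ elsewhere, together with all vectors $\pm\frac1{\sqrt{-3}}(\omega^{a_1},\ldots,\omega^{a_6})$ with $\sum a_i\equiv0\pmod 3$. Then $V$ has $756$ elements, and it is the set of minimal vectors of the $\mathbb Z[\omega]$-lattice $\Lambda$ that it spans: $V=\{v\in\Lambda:\sum|v_i|^2=2\}$, and $\sum|v_i|^2\ge2$ for every nonzero $v\in\Lambda$. (3) For every $k\ge1$, $$f_{6k}=\frac{(-27)^k}{486}\sum_{v\in V}(v_1x_1+\cdots+v_6x_6)^{6k}.$$ -/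

import Mathlib

noncomputable section

namespace Mitchell

open scoped Nat

/-- The primitive cube root of unity `ω = e^{2πi/3}`. -/
def omega : ℂ := Complex.exp (2 * Real.pi * Complex.I / 3)

/-- The matrix of the (unitary, order two) reflection of `ℂ⁶` across the hyperplane
`{x | ∑ i, conj (a i) * x i = 0}` orthogonal to `a`, that is, of
`x ↦ x - 2 * (⟨a, x⟩ / ⟨a, a⟩) • a`. -/
def reflectionMatrix (a : Fin 6 → ℂ) : Matrix (Fin 6) (Fin 6) ℂ :=
  1 - (2 / (star a ⬝ᵥ a)) • Matrix.vecMulVec a (star a)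

/-- For nonzero `a` the reflection has order two; in particular its matrix is invertible. -/
theorem reflectionMatrix_mul_self {a : Fin 6 → ℂ} (ha : a ≠ 0) :
    reflectionMatrix a * reflectionMatrix a = 1 := by
  have h : star a ⬝ᵥ a ≠ 0 := by
    intro h0
    refine ha (funext fun i => ?_)
    have h1 : (∑ i, ‖a i‖ ^ 2 : ℝ) = 0 := by
      have h2 : ((∑ i, ‖a i‖ ^ 2 : ℝ) : ℂ) = 0 := by
        rw [← h0, dotProduct]
        push_cast
        exact Finset.sum_congr rfl fun i _ => (Complex.conj_mul' (a i)).symm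
      exact_mod_cast h2
    have h3 := (Finset.sum_eq_zero_iff_of_nonneg fun i _ => sq_nonneg ‖a i‖).1 h1 i
      (Finset.mem_univ i)
    exact norm_eq_zero.1 (pow_eq_zero_iff two_ne_zero |>.1 h3)
  have hv : Matrix.vecMulVec a (star a) * Matrix.vecMulVec a (star a)
      = (star a ⬝ᵥ a) • Matrix.vecMulVec a (star a) := by
    rw [Matrix.vecMulVec_mul_vecMulVec, Matrix.vecMulVec_smul]
  have hc : 2 / (star a ⬝ᵥ a) * (2 / (star a ⬝ᵥ a) * (star a ⬝ᵥ a))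
      = 2 / (star a ⬝ᵥ a) + 2 / (star a ⬝ᵥ a) := by
    field_simp
    ring
  simp only [reflectionMatrix, sub_mul, mul_sub, one_mul, mul_one, smul_mul_assoc,
    mul_smul_comm, hv, smul_sub, smul_smul]
  rw [hc, add_smul]
  abel

/-- Normal vectors of the hyperplanes `x_i - x_j = 0` (`i ≠ j`), `x_1 - ω x_2 = 0` and
`x_1 + ⋯ + x_6 = 0`. The coordinates of a normal vector are the complex conjugates of the
coefficients of the equation of its hyperplane. -/
def normals : Set (Fin 6 → ℂ) :=
  {a | ∃ i j : Fin 6, i ≠ j ∧ a = Pi.single i 1 - Pi.single j 1} ∪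
    {star ![1, -omega, 0, 0, 0, 0], fun _ => 1}

/-- The Mitchell group `G₃₄`: the group generated by the reflections across the hyperplanes
`x_i - x_j = 0`, `x_1 - ω x_2 = 0` and `x_1 + ⋯ + x_6 = 0`. -/
def G34 : Subgroup (GL (Fin 6) ℂ) :=
  Subgroup.closure
    {g | ∃ a ∈ normals, (g : Matrix (Fin 6) (Fin 6) ℂ) = reflectionMatrix a}

/-- The linear substitution `p(x) ↦ p(A x)` on `ℂ[x_1, …, x_6]`: the variable `x_i` goes to
the linear form `∑ j, A i j * x_j`. -/
def subst (A : Matrix (Fin 6) (Fin 6) ℂ) :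
    MvPolynomial (Fin 6) ℂ →ₐ[ℂ] MvPolynomial (Fin 6) ℂ :=
  MvPolynomial.aeval fun i => ∑ j, MvPolynomial.C (A i j) * MvPolynomial.X j

/-- The ring `ℂ[x_1, …, x_6]^G` of polynomials `p` with `p(g x) = p(x)` for all `g ∈ G`. -/
def invariantRing (G : Subgroup (GL (Fin 6) ℂ)) : Subalgebra ℂ (MvPolynomial (Fin 6) ℂ) where
  carrier := {p | ∀ g ∈ G, subst (g : Matrix (Fin 6) (Fin 6) ℂ) p = p}
  mul_mem' hp hq g hg := by rw [map_mul, hp g hg, hq g hg]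
  add_mem' hp hq g hg := by rw [map_add, hp g hg, hq g hg]
  algebraMap_mem' c g _ := AlgHom.commutes _ c

/-- The monomial symmetric polynomial `m_e` in `x_1, …, x_6`, where `e` is a multiset of
positive integers: the sum of all distinct monomials whose multiset of nonzero exponents
is `e`. -/
def m (e : Multiset ℕ) : MvPolynomial (Fin 6) ℂ :=
  MvPolynomial.msymm (Fin 6) ℂ (Nat.Partition.ofMultiset e)

/-- The multinomial coefficient `(e_1 + ⋯ + e_r)! / (e_1! ⋯ e_r!)`. -/
def multinomialCoeff (e : Multiset ℕ) : ℂ :=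
  (e.sum ! : ℂ) / ((e.map fun a => (a ! : ℂ)).prod)

/-- The partitions `e = (e_1, …, e_r)` of `6k` with `3 ≤ r ≤ 6`, all parts congruent to each
other mod `3`, and all parts divisible by `3` if `r < 6`. -/
def admissible (k : ℕ) : Finset (Nat.Partition (6 * k)) :=
  {e | 3 ≤ e.parts.card ∧ e.parts.card ≤ 6 ∧
    (∀ a ∈ e.parts, ∀ b ∈ e.parts, a ≡ b [MOD 3]) ∧
    (e.parts.card < 6 → ∀ a ∈ e.parts, a ≡ 0 [MOD 3])}

/-- The polynomial `f_{6k}` (used for `k ≥ 1`). -/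
def f (k : ℕ) : MvPolynomial (Fin 6) ℂ :=
  (1 + (-1 : ℂ) ^ k * 27 ^ (k - 1) * 5) • m {6 * k}
    + ∑ s ∈ Finset.Icc 1 k,
        (((6 * k).choose (3 * s) : ℂ) * (1 + (-1 : ℂ) ^ (k + s) * 27 ^ (k - 1))) •
          m {6 * k - 3 * s, 3 * s}
    + ∑ e ∈ admissible k, multinomialCoeff e.parts • m e.parts

open Classical in
/-- The vectors of `ℂ⁶` with `ω^a` in one position, `-ω^b` in another one and `0` elsewhere,
together with the vectors `± (1 / √-3) (ω^{a_1}, …, ω^{a_6})` with `∑ a_i ≡ 0 mod 3`. -/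
def vectors : Finset (Fin 6 → ℂ) :=
  ((Finset.univ : Finset (Fin 6 × Fin 6 × Fin 3 × Fin 3)).filter fun t => t.1 ≠ t.2.1).image
      (fun t => Pi.single t.1 (omega ^ (t.2.2.1 : ℕ))
        - Pi.single t.2.1 (omega ^ (t.2.2.2 : ℕ)))
    ∪ ((Finset.univ : Finset (ℤˣ × (Fin 6 → Fin 3))).filter
        fun t => (∑ i, (t.2 i : ℕ)) ≡ 0 [MOD 3]).image
      (fun t i => ((t.1 : ℤ) : ℂ) * (1 / (Complex.I * (Real.sqrt 3 : ℂ))) *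
        omega ^ (t.2 i : ℕ))

/-- The `ℤ[ω]`-lattice in `ℂ⁶` spanned by `vectors`. -/
def lattice : Submodule (Algebra.adjoin ℤ {omega}) (Fin 6 → ℂ) :=
  Submodule.span (Algebra.adjoin ℤ {omega}) (vectors : Set (Fin 6 → ℂ))

/-- The power sum `p_n = ∑_v (v_1 x_1 + ⋯ + v_6 x_6)^n` over `vectors`. -/
def powerSum (n : ℕ) : MvPolynomial (Fin 6) ℂ :=
  ∑ v ∈ vectors, (∑ i, MvPolynomial.C (v i) * MvPolynomial.X i) ^ n

end Mitchell

end

/-! The closed formula is a comparison of coefficients. The coefficient of `x^s` in `∑_v (v·x)^(6k)`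
is a multinomial coefficient times `∑_v v^s`, and orthogonality of the characters of `ℤ/3` evaluates
that sum. The vectors with six nonzero coordinates give `486/(-27)^k` when all exponents agree
modulo 3, and 0 otherwise (`sum_fullVector`). The vectors with two nonzero coordinates only see
monomials in at most two variables (`sum_pairVector`). Together this gives `f_eq_smul_powerSum`.

For the minimal vectors, scaling by `√-3` places the spanned lattice inside `congruenceLattice`,
whose congruences modulo `√-3` and 3 leave so little room that its vectors of norm at most two can
be listed (`minimal_of_mem_congruenceLattice`). The 756 vectors are thus characterised by membership
and norm. The generating reflections preserve both, so every power sum is invariant.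

For the invariant ring, the Jacobian of any six invariants changes sign under each generating
reflection, and is therefore divisible by the linear forms of 126 hyperplanes (`prod_root_dvd_jac`).
For the six generators the Jacobian has degree `∑ (d_i - 1) = 126`, so once it is nonzero it is a
constant times that product, and it divides every other Jacobian of invariants (`jac_f_dvd`). If `r`
is a homogeneous invariant, Cramer's rule then gives `∇r = ∑ c_i ∇f_i` with polynomial `c_i`. These
are invariants of smaller degree, and Euler's identity recovers `r` from the `c_i` and `f_i`, so
induction on the degree finishes (`adjoin_eq_invariantRing`). Neither the order nor the finiteness
of the group enters.

The Jacobian is shown to be nonzero by evaluating it at an integer point and reducing `ℤ[ω]` modulo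
a prime above 43 (`jac_f_ne_zero`). This also yields algebraic independence. -/

noncomputable section

namespace Mitchell

open MvPolynomial
open scoped Nat

/-! ### Jacobians, the chain rule and algebraic independence. -/

section Jacobian

variable {σ ι : Type*}

/-- The Jacobian matrix `(∂ q_i / ∂ x_j)` of a family of polynomials. -/
def jacobianMatrix (q : ι → MvPolynomial σ ℂ) : Matrix ι σ (MvPolynomial σ ℂ) :=
  Matrix.of fun i j => pderiv j (q i)

@[simp]
theorem jacobianMatrix_apply (q : ι → MvPolynomial σ ℂ) (i : ι) (j : σ) :
    jacobianMatrix q i j = pderiv j (q i) := rfl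

/-- The Jacobian determinant of `|σ|` polynomials in the variables `σ`. -/
def jac [Fintype σ] [DecidableEq σ] (q : σ → MvPolynomial σ ℂ) : MvPolynomial σ ℂ :=
  (jacobianMatrix q).det

/-- A matrix whose `i`-th row consists of forms of degree `r i` has a homogeneous determinant. -/
theorem isHomogeneous_det [Fintype ι] [DecidableEq ι] (N : Matrix ι ι (MvPolynomial σ ℂ))
    (r : ι → ℕ) (h : ∀ i j, (N i j).IsHomogeneous (r i)) : N.det.IsHomogeneous (∑ i, r i) := by
  rw [Matrix.det_apply]
  refine IsHomogeneous.sum _ _ _ fun s _ => ?_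
  have h1 : (∏ i, N (s i) i).IsHomogeneous (∑ i, r i) := by
    rw [← Equiv.sum_comp s r]
    exact IsHomogeneous.prod _ _ _ fun i _ => h _ _
  rcases Int.units_eq_one_or (Equiv.Perm.sign s) with hs | hs <;> rw [hs]
  · simpa using h1
  · simpa using h1.neg

/-- The chain rule for polynomials. -/
theorem pderiv_aeval_eq_sum [Fintype ι] (g : ι → MvPolynomial σ ℂ) (p : MvPolynomial ι ℂ)
    (j : σ) : pderiv j (aeval g p) = ∑ k, aeval g (pderiv k p) * pderiv j (g k) := by
  classical
  induction p using MvPolynomial.induction_on with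
  | C a => simp
  | add p q hp hq => simp only [map_add, hp, hq, add_mul, Finset.sum_add_distrib]
  | mul_X p i hp =>
    have : ∀ k, aeval g (pderiv k (p * X i)) * pderiv j (g k) =
        (aeval g (pderiv k p) * pderiv j (g k)) * g i +
          if k = i then aeval g p * pderiv j (g i) else 0 := by
      intro k
      by_cases hk : k = i
      · subst hk
        simp [Derivation.leibniz]
        ring
      · simp [Derivation.leibniz, pderiv_X_of_ne (Ne.symm hk), hk]
        ring
    simp only [this, Finset.sum_add_distrib, ← Finset.sum_mul, ← hp]
    simp [Derivation.leibniz]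
    ring

/-- A polynomial all of whose partial derivatives vanish is constant. -/
theorem eq_C_of_pderiv_eq_zero (p : MvPolynomial σ ℂ) (h : ∀ i, pderiv i p = 0) :
    p = C (coeff 0 p) := by
  classical
  ext m
  rw [coeff_C]
  split_ifs with hm
  · rw [hm]
  · obtain ⟨i, hi⟩ : ∃ i, m i ≠ 0 := by
      by_contra! hc
      exact hm (Finsupp.ext fun i => (hc i).symm)
    -- This coefficient of the derivative is `m i` times `coeff m p`, and `m i` is invertible in
    -- characteristic zero.
    have h1 := congrArg (coeff (m - Finsupp.single i 1)) (h i)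
    rw [coeff_pderiv, coeff_zero] at h1
    have h2 : m - Finsupp.single i 1 + Finsupp.single i 1 = m := by
      refine tsub_add_cancel_of_le ?_
      rw [Finsupp.single_le_iff]
      omega
    rw [h2] at h1
    rcases mul_eq_zero.1 h1 with h3 | h3
    · exact h3
    · norm_cast at h3

theorem totalDegree_pderiv_lt (p : MvPolynomial σ ℂ) (i : σ) (h : pderiv i p ≠ 0) :
    (pderiv i p).totalDegree < p.totalDegree := by
  classical
  obtain ⟨m, hm, hd⟩ := Finset.exists_mem_eq_sup (pderiv i p).support
    (support_nonempty.2 h) (fun s => s.sum fun _ e => e)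
  rw [MvPolynomial.totalDegree, hd]
  rw [mem_support_iff, coeff_pderiv] at hm
  have h1 : m + Finsupp.single i 1 ∈ p.support := by
    rw [mem_support_iff]
    exact left_ne_zero_of_mul hm
  have h2 := le_totalDegree h1
  rw [Finsupp.sum_add_index' (by simp) (by simp)] at h2
  simp at h2
  omega

/-- The Jacobian criterion for algebraic independence. -/
theorem algebraicIndependent_of_jac_ne_zero [Fintype σ] [DecidableEq σ]
    (q : σ → MvPolynomial σ ℂ) (hq : jac q ≠ 0) : AlgebraicIndependent ℂ q := by
  rw [algebraicIndependent_iff]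
  intro p
  induction hn : p.totalDegree using Nat.strong_induction_on generalizing p with
  | _ n ih =>
    intro hp
    have h1 : ∀ k, aeval q (pderiv k p) = 0 := by
      -- Differentiating the relation puts the vector of `aeval q (pderiv k p)` in the left kernel
      -- of a nonsingular matrix, so each partial derivative of `p` is a relation of smaller degree.
      have h2 : Matrix.vecMul (fun k => aeval q (pderiv k p)) (jacobianMatrix q) = 0 := by
        funext j
        have := pderiv_aeval_eq_sum q p j
        rw [hp, map_zero] at this
        simpa [Matrix.vecMul, dotProduct] using this.symm
      exact fun k => congrFun (Matrix.eq_zero_of_vecMul_eq_zero hq h2) k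
    have h2 : ∀ k, pderiv k p = 0 := by
      intro k
      by_contra hk
      exact hk (ih _ (hn ▸ totalDegree_pderiv_lt p k hk) _ rfl (h1 k))
    rw [eq_C_of_pderiv_eq_zero p h2] at hp ⊢
    rw [aeval_C, algebraMap_eq, C_eq_zero] at hp
    rw [hp, C_0]

end Jacobian

/-! ### Linear substitutions and how gradients transform under them. -/

section Substitution

theorem subst_X (A : Matrix (Fin 6) (Fin 6) ℂ) (i : Fin 6) :
    subst A (X i) = ∑ j, C (A i j) * X j := by
  simp [subst]

theorem subst_C (A : Matrix (Fin 6) (Fin 6) ℂ) (c : ℂ) : subst A (C c) = C c := by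
  simp [subst]

theorem subst_subst (A B : Matrix (Fin 6) (Fin 6) ℂ) (p : MvPolynomial (Fin 6) ℂ) :
    subst B (subst A p) = subst (A * B) p := by
  have : (subst B).comp (subst A) = subst (A * B) := by
    refine algHom_ext fun i => ?_
    simp only [AlgHom.comp_apply, subst_X, map_sum, map_mul, subst_C, Matrix.mul_apply,
      Finset.mul_sum, Finset.sum_mul]
    rw [Finset.sum_comm]
    exact Finset.sum_congr rfl fun j _ => Finset.sum_congr rfl fun k _ => by ring
  exact DFunLike.congr_fun this p

theorem subst_one (p : MvPolynomial (Fin 6) ℂ) : subst 1 p = p := by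
  have : subst 1 = AlgHom.id ℂ _ := by
    refine algHom_ext fun i => ?_
    simp [subst_X, Matrix.one_apply]
  rw [this, AlgHom.id_apply]

/-- Invariance under a group of matrices can be tested on generators. -/
theorem mem_invariantRing_closure {S : Set (GL (Fin 6) ℂ)} {p : MvPolynomial (Fin 6) ℂ}
    (h : ∀ g ∈ S, subst (g : Matrix (Fin 6) (Fin 6) ℂ) p = p) :
    p ∈ invariantRing (Subgroup.closure S) := by
  intro g hg
  induction hg using Subgroup.closure_induction with
  | mem x hx => exact h x hx
  | one => simpa using subst_one p
  | mul x y _ _ hx hy => rw [Units.val_mul, ← subst_subst, hx, hy]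
  | inv x _ hx =>
    conv_lhs => rw [← hx, subst_subst, ← Units.val_mul, mul_inv_cancel, Units.val_one, subst_one]

theorem isHomogeneous_subst (A : Matrix (Fin 6) (Fin 6) ℂ) {p : MvPolynomial (Fin 6) ℂ} {n : ℕ}
    (hp : p.IsHomogeneous n) : (subst A p).IsHomogeneous n := by
  have := hp.aeval (fun i => ∑ j, C (A i j) * X j) (n := 1)
    fun i => IsHomogeneous.sum _ _ _ fun j _ => isHomogeneous_C_mul_X _ _
  rwa [one_mul] at this

theorem homogeneousComponent_subst (A : Matrix (Fin 6) (Fin 6) ℂ) (p : MvPolynomial (Fin 6) ℂ)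
    (n : ℕ) : homogeneousComponent n (subst A p) = subst A (homogeneousComponent n p) := by
  conv_lhs => rw [← sum_homogeneousComponent p, map_sum, map_sum]
  rw [Finset.sum_congr rfl fun i _ => homogeneousComponent_of_mem (n := i) (m := n)
    (isHomogeneous_subst A (homogeneousComponent_isHomogeneous i p))]
  rw [Finset.sum_ite_eq]
  split_ifs with h
  · rfl
  · rw [homogeneousComponent_eq_zero, map_zero]
    simpa using h

theorem pderiv_subst (A : Matrix (Fin 6) (Fin 6) ℂ) (p : MvPolynomial (Fin 6) ℂ) (j : Fin 6) :
    pderiv j (subst A p) = ∑ k, subst A (pderiv k p) * C (A k j) := by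
  rw [subst, pderiv_aeval_eq_sum]
  refine Finset.sum_congr rfl fun k _ => ?_
  congr 1
  simp [pderiv_X, Pi.single_apply]

theorem jacobianMatrix_subst (A : Matrix (Fin 6) (Fin 6) ℂ) {ι : Type*}
    (q : ι → MvPolynomial (Fin 6) ℂ) :
    jacobianMatrix (fun i => subst A (q i)) =
      (jacobianMatrix q).map (subst A) * A.map (C (σ := Fin 6)) :=
  Matrix.ext fun i j => pderiv_subst A (q i) j

theorem jac_subst (A : Matrix (Fin 6) (Fin 6) ℂ) (q : Fin 6 → MvPolynomial (Fin 6) ℂ)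
    (hq : ∀ i, subst A (q i) = q i) : jac q = subst A (jac q) * C A.det := by
  have h := jacobianMatrix_subst A q
  rw [funext hq] at h
  rw [jac]
  conv_lhs => rw [h, Matrix.det_mul]
  congr 1
  · exact ((subst A).map_det _).symm
  · exact ((C : ℂ →+* MvPolynomial (Fin 6) ℂ).map_det A).symm

end Substitution

/-! ### A Jacobian criterion for generating an invariant ring. -/

section Generation

variable {G : Subgroup (GL (Fin 6) ℂ)}

theorem subst_eq_self {p : MvPolynomial (Fin 6) ℂ} (hp : p ∈ invariantRing G)
    {g : GL (Fin 6) ℂ} (hg : g ∈ G) : subst (g : Matrix (Fin 6) (Fin 6) ℂ) p = p := hp g hg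

theorem homogeneousComponent_mem_invariantRing {p : MvPolynomial (Fin 6) ℂ}
    (hp : p ∈ invariantRing G) (n : ℕ) : homogeneousComponent n p ∈ invariantRing G :=
  fun g hg => by rw [← homogeneousComponent_subst, hp g hg]

/-- If the gradient of an invariant is a combination of the gradients of invariants with nonzero
Jacobian, then the coefficients are invariants. -/
theorem subst_coeff_eq_self (A : Matrix (Fin 6) (Fin 6) ℂ) {f : Fin 6 → MvPolynomial (Fin 6) ℂ}
    {p : MvPolynomial (Fin 6) ℂ} (hf : ∀ i, subst A (f i) = f i) (hJ : jac f ≠ 0)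
    (hp : subst A p = p) {c : Fin 6 → MvPolynomial (Fin 6) ℂ}
    (hc : Matrix.vecMul c (jacobianMatrix f) = fun j => pderiv j p) (i : Fin 6) :
    subst A (c i) = c i := by
  have h1 : jacobianMatrix f = (jacobianMatrix f).map (subst A) * A.map (C (σ := Fin 6)) := by
    have h := jacobianMatrix_subst A f
    rwa [funext hf] at h
  have h2 : (fun j => pderiv j p) =
      Matrix.vecMul (fun k => subst A (pderiv k p)) (A.map (C (σ := Fin 6))) :=
    funext fun j => by
      conv_lhs => rw [← hp, pderiv_subst]
      rfl
  have h3 : (fun k => subst A (pderiv k p)) =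
      Matrix.vecMul (fun i => subst A (c i)) ((jacobianMatrix f).map (subst A)) :=
    funext fun k => by
      rw [← congrFun hc k, Matrix.vecMul, dotProduct, map_sum]
      exact Finset.sum_congr rfl fun i _ => map_mul _ _ _
  -- Both gradients transform by the same matrix `A`, so the transformed coefficients solve the same
  -- linear system; the nonzero Jacobian makes its solution unique.
  have h4 : Matrix.vecMul (fun i => subst A (c i)) (jacobianMatrix f) =
      Matrix.vecMul c (jacobianMatrix f) := by
    rw [hc, h2, h3, Matrix.vecMul_vecMul, ← h1]
  have h5 : (fun i => subst A (c i)) - c = 0 := by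
    refine Matrix.eq_zero_of_vecMul_eq_zero (M := jacobianMatrix f) hJ ?_
    rw [Matrix.sub_vecMul, h4, sub_self]
  have h6 := congrFun h5 i
  rwa [Pi.sub_apply, Pi.zero_apply, sub_eq_zero] at h6

/-- Homogeneous invariants whose Jacobian is nonzero and divides the Jacobian of any six
invariants generate the ring of invariants. -/
theorem adjoin_eq_invariantRing {f : Fin 6 → MvPolynomial (Fin 6) ℂ} {d : Fin 6 → ℕ}
    (hd : ∀ i, 0 < d i) (hf : ∀ i, f i ∈ invariantRing G) (hhom : ∀ i, (f i).IsHomogeneous (d i))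
    (hJ : jac f ≠ 0)
    (hdvd : ∀ q : Fin 6 → MvPolynomial (Fin 6) ℂ, (∀ i, q i ∈ invariantRing G) → jac f ∣ jac q) :
    Algebra.adjoin ℂ (Set.range f) = invariantRing G := by
  refine le_antisymm (Algebra.adjoin_le (Set.range_subset_iff.2 hf)) fun p => ?_
  induction hn : p.totalDegree using Nat.strong_induction_on generalizing p with
  | _ n ih =>
  intro hp
  rw [← sum_homogeneousComponent p]
  refine Subalgebra.sum_mem _ fun m hm => ?_
  have hmn : m ≤ n := by
    rw [Finset.mem_range] at hm
    omega
  have hr := homogeneousComponent_mem_invariantRing hp m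
  have hrh := homogeneousComponent_isHomogeneous m p
  generalize homogeneousComponent m p = r at hr hrh
  rcases Nat.eq_zero_or_pos m with rfl | hm0
  · rw [totalDegree_eq_zero_iff_eq_C.1 (Nat.le_zero.1 hrh.totalDegree_le)]
    exact Subalgebra.algebraMap_mem _ _
  -- These Jacobians are the numerators in Cramer's rule for `∇r` in terms of the `∇f_i`;
  -- divisibility makes the quotients `c i` polynomials.
  have hdv : ∀ i, jac f ∣ jac (Function.update f i r) := by
    refine fun i => hdvd _ fun k => ?_
    by_cases hk : k = i
    · subst hk
      simpa using hr
    · simpa [hk] using hf k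
  choose c hc using hdv
  have hcr : ∀ i, jac (Function.update f i r) =
      Matrix.cramer (jacobianMatrix f).transpose (fun j => pderiv j r) i := by
    intro i
    rw [Matrix.cramer_transpose_apply, jac]
    congr 1
    ext1 k j
    by_cases hk : k = i
    · subst hk
      simp
    · simp [hk]
  have hgrad : Matrix.vecMul c (jacobianMatrix f) = fun j => pderiv j r := by
    have h1 := Matrix.mulVec_cramer (jacobianMatrix f).transpose (fun j => pderiv j r)
    have h2 : Matrix.cramer (jacobianMatrix f).transpose (fun j => pderiv j r) = jac f • c := by
      funext i
      rw [← hcr, hc, Pi.smul_apply, smul_eq_mul]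
    rw [h2, Matrix.det_transpose, Matrix.mulVec_transpose, Matrix.smul_vecMul] at h1
    exact smul_right_injective _ hJ h1
  -- Replacing `f i` by `r` changes the degree of the Jacobian from `∑ (d k - 1)` by `(m - 1) - (d i
  -- - 1)`, so `c i` has degree at most `m - d i`.
  have hcdeg : ∀ i, (c i).totalDegree < n := by
    intro i
    by_cases hci : c i = 0
    · rw [hci, totalDegree_zero]
      omega
    have h1 := congrArg totalDegree (hc i)
    rw [totalDegree_mul_of_isDomain hJ hci] at h1
    have h2 : (jac f).totalDegree = ∑ k, (d k - 1) :=
      (isHomogeneous_det _ (fun k => d k - 1) fun k j => (hhom k).pderiv).totalDegree hJ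
    have h3 : (jac (Function.update f i r)).totalDegree ≤
        ∑ k, (Function.update d i m k - 1) := by
      refine (isHomogeneous_det _ (fun k => Function.update d i m k - 1)
        fun k j => ?_).totalDegree_le
      by_cases hk : k = i
      · subst hk
        simpa using hrh.pderiv
      · simpa [hk] using (hhom k).pderiv
    rw [← Finset.add_sum_erase _ _ (Finset.mem_univ i)] at h2 h3
    rw [Finset.sum_congr rfl fun k hk => by
      rw [Function.update_of_ne (Finset.ne_of_mem_erase hk)]] at h3
    rw [Function.update_self] at h3
    have := hd i
    omega
  have hcmem : ∀ i, c i ∈ Algebra.adjoin ℂ (Set.range f) := fun i =>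
    ih _ (hcdeg i) _ rfl fun g hg =>
      subst_coeff_eq_self _ (fun k => subst_eq_self (hf k) hg) hJ (subst_eq_self hr hg) hgrad i
  -- Pairing the gradient identity with the vector of variables and applying Euler's identity on
  -- both sides.
  have heuler : (m : ℂ) • r = ∑ i, (d i : ℂ) • (c i * f i) := by
    have h1 := hrh.sum_X_mul_pderiv
    rw [← Nat.cast_smul_eq_nsmul ℂ] at h1
    rw [← h1]
    have h2 : ∀ j, pderiv j r = ∑ i, c i * pderiv j (f i) := fun j => by
      rw [← congrFun hgrad j]
      rfl
    simp only [h2, Finset.mul_sum]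
    rw [Finset.sum_comm]
    refine Finset.sum_congr rfl fun i _ => ?_
    rw [← mul_smul_comm, Nat.cast_smul_eq_nsmul ℂ, ← (hhom i).sum_X_mul_pderiv, Finset.mul_sum]
    exact Finset.sum_congr rfl fun j _ => by ring
  have hm' : (m : ℂ) ≠ 0 := by exact_mod_cast hm0.ne'
  rw [← inv_smul_smul₀ hm' r, heuler]
  exact Subalgebra.smul_mem _ (Subalgebra.sum_mem _ fun i _ => Subalgebra.smul_mem _
    (Subalgebra.mul_mem _ (hcmem i) (Algebra.subset_adjoin ⟨i, rfl⟩)) _) _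

end Generation

/-! ### Arithmetic of the Eisenstein integers. -/

section Eisenstein

theorem omega_isPrimitiveRoot : IsPrimitiveRoot omega 3 := by
  simpa [omega] using Complex.isPrimitiveRoot_exp 3 (by norm_num)

theorem omega_pow_three : omega ^ 3 = 1 := omega_isPrimitiveRoot.pow_eq_one

theorem omega_sq : omega ^ 2 = -1 - omega := by
  have h := omega_isPrimitiveRoot.geom_sum_eq_zero (by norm_num)
  simp only [Finset.sum_range_succ, Finset.sum_range_zero] at h
  linear_combination h

theorem omega_ne_zero : omega ≠ 0 := omega_isPrimitiveRoot.ne_zero (by norm_num)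

theorem omega_eq : omega = -1 / 2 + (Real.sqrt 3 / 2 : ℝ) * Complex.I := by
  have h : (2 * Real.pi * Complex.I / 3 : ℂ) = ((2 * Real.pi / 3 : ℝ) : ℂ) * Complex.I := by
    push_cast
    ring
  have h2 : 2 * Real.pi / 3 = Real.pi - Real.pi / 3 := by ring
  rw [omega, h, Complex.exp_mul_I, ← Complex.ofReal_cos, ← Complex.ofReal_sin, h2,
    Real.cos_pi_sub, Real.sin_pi_sub, Real.cos_pi_div_three, Real.sin_pi_div_three]
  push_cast
  ring

theorem star_omega : star omega = omega ^ 2 := by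
  rw [omega_sq, omega_eq]
  apply Complex.ext <;> simp
  norm_num

/-- The square root `√-3`. -/
def theta : ℂ := Complex.I * (Real.sqrt 3 : ℂ)

theorem theta_eq : theta = 1 + 2 * omega := by
  rw [theta, omega_eq]
  push_cast
  ring

theorem theta_sq : theta ^ 2 = -3 := by
  rw [theta_eq]
  linear_combination 4 * omega_sq

theorem theta_ne_zero : theta ≠ 0 := by
  intro h
  have := theta_sq
  rw [h] at this
  norm_num at this

theorem norm_theta_sq : ‖theta‖ ^ 2 = 3 := by
  rw [← norm_pow, theta_sq]
  simp

/-- The Eisenstein integer `a + b ω`. -/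
def eis (a b : ℤ) : ℂ := a + b * omega

theorem norm_eis_sq (a b : ℤ) : ‖eis a b‖ ^ 2 = ((a ^ 2 - a * b + b ^ 2 : ℤ) : ℝ) := by
  have h3 : Real.sqrt 3 * Real.sqrt 3 = 3 := Real.mul_self_sqrt (by norm_num)
  rw [← Complex.normSq_eq_norm_sq, eis, omega_eq, Complex.normSq_apply]
  simp
  linear_combination (b : ℝ) ^ 2 / 4 * h3

theorem theta_mul_eis (c d : ℤ) : theta * eis c d = eis (c - 2 * d) (2 * c - d) := by
  simp only [eis, theta_eq]
  push_cast
  linear_combination 2 * (d : ℂ) * omega_sq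

theorem omega_mul_eis (a b : ℤ) : omega * eis a b = eis (-b) (a - b) := by
  simp only [eis]
  push_cast
  linear_combination (b : ℂ) * omega_sq

theorem eis_add (a b c d : ℤ) : eis a b + eis c d = eis (a + c) (b + d) := by
  simp only [eis]
  push_cast
  ring

theorem int_mul_eis (n a b : ℤ) : (n : ℂ) * eis a b = eis (n * a) (n * b) := by
  simp only [eis]
  push_cast
  ring

theorem neg_eis (a b : ℤ) : -eis a b = eis (-a) (-b) := by
  simp only [eis]
  push_cast
  ring

/-- The coordinates of a power of `ω`. -/
theorem omega_pow_eq_eis (k : Fin 3) : ∃ c d : ℤ, omega ^ (k : ℕ) = eis c d ∧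
    c + d ≡ 1 [ZMOD 3] ∧ d ≡ (k : ℕ) [ZMOD 3] := by
  fin_cases k
  · exact ⟨1, 0, by simp [eis], by decide, by decide⟩
  · exact ⟨0, 1, by simp [eis], by decide, by decide⟩
  · exact ⟨-1, -1, by simp [eis, omega_sq]; ring, by decide, by decide⟩

theorem norm_form_nonneg (a b : ℤ) : 0 ≤ a ^ 2 - a * b + b ^ 2 := by
  nlinarith [sq_nonneg (a - b), sq_nonneg a, sq_nonneg b]

theorem norm_form_eq_zero {a b : ℤ} (h : a ^ 2 - a * b + b ^ 2 = 0) : a = 0 ∧ b = 0 := by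
  constructor <;> nlinarith [sq_nonneg (a - b), sq_nonneg a, sq_nonneg b, sq_nonneg (a - 2 * b),
    sq_nonneg (b - 2 * a)]

/-- The number `a + b` is the residue of `a + bω` modulo `√-3`, because `ω ≡ 1`. Norms are therefore
squares modulo 3, which excludes the norm 2. -/
theorem norm_form_modEq (a b : ℤ) : a ^ 2 - a * b + b ^ 2 ≡ (a + b) ^ 2 [ZMOD 3] :=
  (Int.modEq_iff_dvd.2 ⟨a * b, by ring⟩)

/-- The Eisenstein integers of norm one are `± ω ^ k`. -/
theorem eis_of_norm_form_eq_one {a b : ℤ} (h : a ^ 2 - a * b + b ^ 2 = 1) :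
    ∃ (s : ℤˣ) (k : Fin 3), eis a b = ((s : ℤ) : ℂ) * omega ^ (k : ℕ) ∧
      a + b ≡ s [ZMOD 3] ∧ b ≡ s * (k : ℕ) [ZMOD 3] := by
  have ha : a ≤ 1 ∧ -1 ≤ a := by
    constructor <;> nlinarith [sq_nonneg (a - 2 * b)]
  have hb : b ≤ 1 ∧ -1 ≤ b := by
    constructor <;> nlinarith [sq_nonneg (b - 2 * a)]
  obtain ⟨ha1, ha2⟩ := ha
  obtain ⟨hb1, hb2⟩ := hb
  interval_cases a <;> interval_cases b <;> simp at h
  · exact ⟨1, 2, by simp [eis, omega_sq]; ring, by decide, by decide⟩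
  · exact ⟨-1, 0, by simp [eis], by decide, by decide⟩
  · exact ⟨-1, 1, by simp [eis], by decide, by decide⟩
  · exact ⟨1, 1, by simp [eis], by decide, by decide⟩
  · exact ⟨1, 0, by simp [eis], by decide, by decide⟩
  · exact ⟨-1, 2, by simp [eis, omega_sq]; ring, by decide, by decide⟩

end Eisenstein

/-! ### The lattice and its minimal vectors. -/

section Lattice

theorem mem_vectors {v : Fin 6 → ℂ} : v ∈ vectors ↔
    (∃ (i j : Fin 6) (a b : Fin 3), i ≠ j ∧
      v = Pi.single i (omega ^ (a : ℕ)) - Pi.single j (omega ^ (b : ℕ))) ∨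
    ∃ (s : ℤˣ) (a : Fin 6 → Fin 3), (∑ i, (a i : ℕ)) ≡ 0 [MOD 3] ∧
      v = fun i => ((s : ℤ) : ℂ) * (1 / theta) * omega ^ (a i : ℕ) := by
  classical
  simp only [vectors, Finset.mem_union, Finset.mem_image, Finset.mem_filter, Finset.mem_univ,
    true_and, Prod.exists, theta]
  constructor
  · rintro (⟨i, j, a, b, h, rfl⟩ | ⟨s, a, h, rfl⟩)
    · exact Or.inl ⟨i, j, a, b, h, rfl⟩
    · exact Or.inr ⟨s, a, h, rfl⟩
  · rintro (⟨i, j, a, b, h, rfl⟩ | ⟨s, a, h, rfl⟩)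
    · exact Or.inl ⟨i, j, a, b, h, rfl⟩
    · exact Or.inr ⟨s, a, h, rfl⟩

/-- The lattice of all `u / √-3` where `u` has Eisenstein integer coordinates that are congruent
to each other modulo `√-3` and whose sum is divisible by `3`. -/
def congruenceLattice : Set (Fin 6 → ℂ) :=
  {v | ∃ a b : Fin 6 → ℤ, (∀ i, theta * v i = eis (a i) (b i)) ∧
    (∀ i j, a i + b i ≡ a j + b j [ZMOD 3]) ∧ (3 : ℤ) ∣ ∑ i, a i ∧ (3 : ℤ) ∣ ∑ i, b i}

/-- This is the case of common residue zero: multiplication by `√-3` turns the residue into `3 (c i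
- d i)`, and turns a sum divisible by `√-3` into one divisible by 3. -/
theorem mem_congruenceLattice_of_integral {v : Fin 6 → ℂ} (c d : Fin 6 → ℤ)
    (h : ∀ i, v i = eis (c i) (d i)) (hs : (3 : ℤ) ∣ ∑ i, (c i + d i)) :
    v ∈ congruenceLattice := by
  refine ⟨fun i => c i - 2 * d i, fun i => 2 * c i - d i, fun i => by rw [h, theta_mul_eis],
    fun i j => Int.modEq_iff_dvd.2 ⟨(c j - d j) - (c i - d i), by ring⟩, ?_, ?_⟩
  · have : ∑ i, (c i - 2 * d i) = ∑ i, (c i + d i) - 3 * ∑ i, d i := by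
      rw [Finset.mul_sum, ← Finset.sum_sub_distrib]
      exact Finset.sum_congr rfl fun i _ => by ring
    rw [this]
    exact dvd_sub hs (dvd_mul_right _ _)
  · have : ∑ i, (2 * c i - d i) = 2 * ∑ i, (c i + d i) - 3 * ∑ i, d i := by
      rw [Finset.mul_sum, Finset.mul_sum, ← Finset.sum_sub_distrib]
      exact Finset.sum_congr rfl fun i _ => by ring
    rw [this]
    exact dvd_sub (hs.mul_left _) (dvd_mul_right _ _)

theorem vectors_subset_congruenceLattice {v : Fin 6 → ℂ} (hv : v ∈ vectors) :
    v ∈ congruenceLattice := by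
  rcases mem_vectors.1 hv with ⟨i, j, a, b, hij, rfl⟩ | ⟨s, a, ha, rfl⟩
  · obtain ⟨c, d, h, h1, -⟩ := omega_pow_eq_eis a
    obtain ⟨c', d', h', h1', -⟩ := omega_pow_eq_eis b
    rw [h, h']
    refine mem_congruenceLattice_of_integral
      (Pi.single i c - Pi.single j c') (Pi.single i d - Pi.single j d') (fun k => ?_) ?_
    · by_cases hi : k = i
      · subst hi
        simp [hij]
      · by_cases hj : k = j
        · subst hj
          simp [hi, neg_eis]
        · simp [hi, hj, eis]
    · simp only [Pi.sub_apply, Finset.sum_add_distrib, Finset.sum_sub_distrib,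
        Finset.sum_pi_single', Finset.mem_univ, if_true]
      have := (h1'.trans h1.symm).dvd
      convert this using 1
      ring
  · choose c d h h1 h2 using omega_pow_eq_eis
    refine ⟨fun i => s * c (a i), fun i => s * d (a i), fun i => ?_, fun i j => ?_, ?_, ?_⟩
    · rw [← int_mul_eis, ← h]
      field_simp [theta_ne_zero]
    · simp only [← mul_add]
      exact Int.ModEq.mul_left _ ((h1 _).trans (h1 _).symm)
    · rw [← Finset.mul_sum]
      refine Dvd.dvd.mul_left ?_ _
      -- Every power of `ω` has residue 1, and there are six of them, so the residues add up to a
      -- multiple of 3.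
      have e1 : ∑ i, (c (a i) + d (a i)) ≡ ∑ _i : Fin 6, 1 [ZMOD 3] :=
        Int.ModEq.sum fun i _ => h1 _
      have e2 : ∑ i, d (a i) ≡ ∑ i, (((a i : ℕ) : ℕ) : ℤ) [ZMOD 3] :=
        Int.ModEq.sum fun i _ => h2 _
      rw [Finset.sum_add_distrib] at e1
      have e3 : ∑ i, (((a i : ℕ) : ℕ) : ℤ) ≡ 0 [ZMOD 3] := by
        exact_mod_cast (Int.natCast_modEq_iff.2 ha)
      have e4 := e1.sub (e2.trans e3)
      rw [add_sub_cancel_right] at e4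
      exact Int.modEq_zero_iff_dvd.1 (e4.trans (by decide))
    · rw [← Finset.mul_sum]
      refine Dvd.dvd.mul_left ?_ _
      have e2 : ∑ i, d (a i) ≡ ∑ i, (((a i : ℕ) : ℕ) : ℤ) [ZMOD 3] :=
        Int.ModEq.sum fun i _ => h2 _
      have e3 : ∑ i, (((a i : ℕ) : ℕ) : ℤ) ≡ 0 [ZMOD 3] := by
        exact_mod_cast (Int.natCast_modEq_iff.2 ha)
      exact Int.modEq_zero_iff_dvd.1 (e2.trans e3)

theorem add_mem_congruenceLattice {v w : Fin 6 → ℂ} (hv : v ∈ congruenceLattice)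
    (hw : w ∈ congruenceLattice) : v + w ∈ congruenceLattice := by
  obtain ⟨a, b, h1, h2, h3, h4⟩ := hv
  obtain ⟨c, d, h1', h2', h3', h4'⟩ := hw
  refine ⟨a + c, b + d, fun i => ?_, fun i j => ?_, ?_, ?_⟩
  · rw [Pi.add_apply, mul_add, h1, h1', eis_add]
    rfl
  · have := (h2 i j).add (h2' i j)
    simpa [add_add_add_comm] using this
  · simpa [Finset.sum_add_distrib] using dvd_add h3 h3'
  · simpa [Finset.sum_add_distrib] using dvd_add h4 h4'

theorem smul_mem_congruenceLattice {z : ℂ} (hz : z ∈ Algebra.adjoin ℤ {omega}) :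
    ∀ v ∈ congruenceLattice, z • v ∈ congruenceLattice := by
  induction hz using Algebra.adjoin_induction with
  | mem x hx =>
    rw [Set.mem_singleton_iff] at hx
    subst hx
    rintro v ⟨a, b, h1, h2, h3, h4⟩
    refine ⟨fun i => -b i, fun i => a i - b i, fun i => ?_, fun i j => ?_, ?_, ?_⟩
    · rw [Pi.smul_apply, smul_eq_mul, mul_left_comm, h1, omega_mul_eis]
    · have e := (h2 i j).dvd
      refine Int.modEq_iff_dvd.2 ?_
      have e2 : -b j + (a j - b j) - (-b i + (a i - b i)) =
          (a j + b j - (a i + b i)) - 3 * (b j - b i) := by ring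
      rw [e2]
      exact dvd_sub e (dvd_mul_right _ _)
    · simpa using h4
    · simpa using dvd_sub h3 h4
  | algebraMap n =>
    rintro v ⟨a, b, h1, h2, h3, h4⟩
    refine ⟨fun i => n * a i, fun i => n * b i, fun i => ?_, fun i j => ?_, ?_, ?_⟩
    · rw [Pi.smul_apply, smul_eq_mul, mul_left_comm, h1, ← int_mul_eis]
      rfl
    · simpa [mul_add] using (h2 i j).mul_left n
    · simpa [← Finset.mul_sum] using h3.mul_left n
    · simpa [← Finset.mul_sum] using h4.mul_left n
  | add x y _ _ hx hy =>
    intro v hv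
    rw [add_smul]
    exact add_mem_congruenceLattice (hx v hv) (hy v hv)
  | mul x y _ _ hx hy =>
    intro v hv
    rw [mul_smul]
    exact hx _ (hy v hv)

/-- Only this inclusion is needed: norm bounds pass to the smaller lattice, and `vectors` lies in
its own span. -/
theorem lattice_subset_congruenceLattice {v : Fin 6 → ℂ} (hv : v ∈ lattice) :
    v ∈ congruenceLattice := by
  induction hv using Submodule.span_induction with
  | mem x hx => exact vectors_subset_congruenceLattice hx
  | zero => exact mem_congruenceLattice_of_integral 0 0 (by simp [eis]) (by simp)
  | add x y _ _ hx hy => exact add_mem_congruenceLattice hx hy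
  | smul z x _ hx => exact smul_mem_congruenceLattice z.2 x hx

theorem sum_norm_sq_eq {v : Fin 6 → ℂ} {a b : Fin 6 → ℤ}
    (h : ∀ i, theta * v i = eis (a i) (b i)) :
    3 * ∑ i, ‖v i‖ ^ 2 = ((∑ i, (a i ^ 2 - a i * b i + b i ^ 2) : ℤ) : ℝ) := by
  rw [Finset.mul_sum, Int.cast_sum]
  refine Finset.sum_congr rfl fun i _ => ?_
  rw [← norm_eis_sq, ← h, norm_mul, mul_pow, norm_theta_sq]

/-- A vector with Eisenstein integer coordinates whose sum is divisible by `√-3` is zero, or has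
norm at least two, with equality only for vectors of the first kind in `vectors`. -/
theorem minimal_of_integral {v : Fin 6 → ℂ} {c d : Fin 6 → ℤ} (h : ∀ i, v i = eis (c i) (d i))
    (hs : (3 : ℤ) ∣ ∑ i, (c i + d i)) (hv : v ≠ 0) (hle : ∑ i, ‖v i‖ ^ 2 ≤ 2) :
    v ∈ vectors ∧ ∑ i, ‖v i‖ ^ 2 = 2 := by
  classical
  set n : Fin 6 → ℤ := fun i => c i ^ 2 - c i * d i + d i ^ 2 with hn
  have hsum : ∑ i, ‖v i‖ ^ 2 = ((∑ i, n i : ℤ) : ℝ) := by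
    rw [Int.cast_sum]
    exact Finset.sum_congr rfl fun i _ => by rw [h, norm_eis_sq]
  rw [hsum] at hle ⊢
  have hle' : ∑ i, n i ≤ 2 := by exact_mod_cast hle
  have hn0 : ∀ i, 0 ≤ n i := fun i => norm_form_nonneg _ _
  have hnot : ∀ i, n i = 0 ∨ n i = 1 := by
    intro i
    have h1 := Finset.single_le_sum (fun i _ => hn0 i) (Finset.mem_univ i)
    have h2 : n i ≠ 2 := by
      intro h2
      have h3 : n i ≡ (c i + d i) ^ 2 [ZMOD 3] := norm_form_modEq (c i) (d i)
      rw [h2] at h3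
      rw [Int.ModEq, pow_two, Int.mul_emod] at h3
      rcases (by omega : (c i + d i) % 3 = 0 ∨ (c i + d i) % 3 = 1 ∨ (c i + d i) % 3 = 2)
        with h4 | h4 | h4 <;> rw [h4] at h3 <;> omega
    have := hn0 i
    omega
  set T : Finset (Fin 6) := Finset.univ.filter fun i => n i = 1 with hT
  have hcard : ∑ i, n i = T.card := by
    rw [hT, Finset.card_filter, Nat.cast_sum]
    refine Finset.sum_congr rfl fun i _ => ?_
    rcases hnot i with h1 | h1 <;> simp [h1]
  have hout : ∀ i, i ∉ T → c i = 0 ∧ d i = 0 := by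
    intro i hi
    have h1 : n i ≠ 1 := by simpa [hT] using hi
    exact norm_form_eq_zero ((hnot i).resolve_right h1)
  have hunit : ∀ i ∈ T, ∃ (s : ℤˣ) (k : Fin 3), v i = ((s : ℤ) : ℂ) * omega ^ (k : ℕ) ∧
      c i + d i ≡ s [ZMOD 3] := by
    intro i hi
    obtain ⟨s, k, h1, h2, -⟩ := eis_of_norm_form_eq_one (Finset.mem_filter.1 hi).2
    exact ⟨s, k, by rw [h, h1], h2⟩
  have hsT : (3 : ℤ) ∣ ∑ i ∈ T, (c i + d i) := by
    rwa [Finset.sum_subset (Finset.subset_univ T)]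
    intro i _ hi
    rw [(hout i hi).1, (hout i hi).2, add_zero]
  have hzero : ∀ i, i ∉ T → v i = 0 := by
    intro i hi
    rw [h, (hout i hi).1, (hout i hi).2]
    simp [eis]
  have hT2 : T.card = 2 := by
    have h2 : T.card ≤ 2 := by
      rw [hcard] at hle'
      exact_mod_cast hle'
    have h0 : T.card ≠ 0 := by
      intro h0
      refine hv (funext fun i => hzero i ?_)
      rw [Finset.card_eq_zero.1 h0]
      simp
    -- A single nonzero coordinate would be a unit, whose residue is ±1 rather than 0.
    have h1 : T.card ≠ 1 := by
      intro h1
      obtain ⟨i, hi⟩ := Finset.card_eq_one.1 h1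
      rw [hi, Finset.sum_singleton] at hsT
      obtain ⟨s, k, -, h3⟩ := hunit i (by simp [hi])
      have h4 := h3.symm.trans (Int.modEq_zero_iff_dvd.2 hsT)
      rcases Int.units_eq_one_or s with rfl | rfl <;> revert h4 <;> decide
    omega
  refine ⟨?_, by rw [hcard, hT2]; norm_num⟩
  obtain ⟨i, j, hij, hTij⟩ := Finset.card_eq_two.1 hT2
  rw [hTij, Finset.sum_pair hij] at hsT
  obtain ⟨s, k, h1, h2⟩ := hunit i (by simp [hTij])
  obtain ⟨s', k', h1', h2'⟩ := hunit j (by simp [hTij])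
  have hss : (s : ℤ) + s' ≡ 0 [ZMOD 3] := (h2.add h2').symm.trans (Int.modEq_zero_iff_dvd.2 hsT)
  have hveq : v = Pi.single i (v i) + Pi.single j (v j) := by
    funext l
    by_cases hl : l = i
    · subst hl
      simp [hij]
    · by_cases hl' : l = j
      · subst hl'
        simp [hl]
      · simp [hl, hl', hzero l (by simp [hTij, hl, hl'])]
  rw [mem_vectors]
  left
  -- The two residues `s` and `s'` cancel modulo 3, so the signs are opposite.
  rcases Int.units_eq_one_or s with rfl | rfl <;> rcases Int.units_eq_one_or s' with rfl | rfl
  · exact absurd hss (by decide)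
  · refine ⟨i, j, k, k', hij, ?_⟩
    rw [hveq, h1, h1', sub_eq_add_neg, ← Pi.single_neg]
    simp
  · refine ⟨j, i, k', k, hij.symm, ?_⟩
    rw [hveq, h1, h1', sub_eq_add_neg, ← Pi.single_neg, add_comm]
    simp
  · exact absurd hss (by decide)

/-- The nonzero vectors of norm at most two in `congruenceLattice` are those of `vectors`. -/
theorem minimal_of_mem_congruenceLattice {v : Fin 6 → ℂ} (hL : v ∈ congruenceLattice)
    (hv : v ≠ 0) (hle : ∑ i, ‖v i‖ ^ 2 ≤ 2) : v ∈ vectors ∧ ∑ i, ‖v i‖ ^ 2 = 2 := by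
  obtain ⟨a, b, h1, h2, h3, h4⟩ := hL
  -- If the common residue is zero, `v` itself has Eisenstein integer coordinates. If not, all six
  -- coordinates of `√-3 v` are nonzero with total norm at most 6, so each is a unit.
  by_cases h0 : (3 : ℤ) ∣ a 0 + b 0
  · have h5 : ∀ i, ∃ d, b i - 2 * a i = 3 * d := by
      intro i
      obtain ⟨t, ht⟩ := Int.modEq_zero_iff_dvd.1 ((h2 i 0).trans (Int.modEq_zero_iff_dvd.2 h0))
      exact ⟨t - a i, by linarith⟩
    choose d hd using h5
    have e : ∀ i, v i = eis (a i + 2 * d i) (d i) := by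
      intro i
      refine mul_left_cancel₀ theta_ne_zero ?_
      rw [h1, theta_mul_eis]
      congr 1
      · ring
      · have := hd i
        linarith
    refine minimal_of_integral e ?_ hv hle
    have : ∑ i, (a i + 2 * d i + d i) = ∑ i, a i + 3 * ∑ i, d i := by
      rw [Finset.mul_sum, ← Finset.sum_add_distrib]
      exact Finset.sum_congr rfl fun i _ => by ring
    rw [this]
    exact dvd_add h3 (dvd_mul_right _ _)
  · have hpos : ∀ i, 1 ≤ a i ^ 2 - a i * b i + b i ^ 2 := by
      intro i
      have hne : a i ^ 2 - a i * b i + b i ^ 2 ≠ 0 := by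
        intro hz
        obtain ⟨ha, hb⟩ := norm_form_eq_zero hz
        have := h2 i 0
        rw [ha, hb] at this
        exact h0 (Int.modEq_zero_iff_dvd.1 this.symm)
      have := norm_form_nonneg (a i) (b i)
      omega
    have hsum := sum_norm_sq_eq h1
    have h6 : ∑ i, (a i ^ 2 - a i * b i + b i ^ 2) ≤ 6 := by
      have : ((∑ i, (a i ^ 2 - a i * b i + b i ^ 2) : ℤ) : ℝ) ≤ (6 : ℤ) := by
        rw [← hsum]
        push_cast
        linarith
      exact_mod_cast this
    have hone : ∀ i, a i ^ 2 - a i * b i + b i ^ 2 = 1 := by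
      intro i
      have h7 : ∑ _j ∈ Finset.univ.erase i, (1 : ℤ) ≤
          ∑ j ∈ Finset.univ.erase i, (a j ^ 2 - a j * b j + b j ^ 2) :=
        Finset.sum_le_sum fun j _ => hpos j
      rw [← Finset.add_sum_erase _ _ (Finset.mem_univ i)] at h6
      rw [Finset.sum_const, Finset.card_erase_of_mem (Finset.mem_univ i), Finset.card_univ,
        Fintype.card_fin] at h7
      norm_num only [smul_eq_mul, nsmul_eq_mul] at h7
      have := hpos i
      linarith
    constructor
    · choose s k hs hab hb using fun i => eis_of_norm_form_eq_one (hone i)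
      have hs0 : ∀ i, s i = s 0 := by
        intro i
        have := (hab i).symm.trans ((h2 i 0).trans (hab 0))
        rcases Int.units_eq_one_or (s i) with h | h <;>
          rcases Int.units_eq_one_or (s 0) with h' | h' <;> rw [h, h'] at this ⊢ <;>
          revert this <;> decide
      rw [mem_vectors]
      right
      refine ⟨s 0, k, ?_, funext fun i => mul_left_cancel₀ theta_ne_zero ?_⟩
      · have e1 : ∑ i, b i ≡ ∑ i, (s 0 : ℤ) * ((k i : ℕ) : ℤ) [ZMOD 3] :=
          Int.ModEq.sum fun i _ => by
            have := hb i
            rwa [hs0 i] at this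
        rw [← Finset.mul_sum] at e1
        have e2 := (e1.symm.trans (Int.modEq_zero_iff_dvd.2 h4)).mul_left (s 0 : ℤ)
        rw [← mul_assoc, Int.units_coe_mul_self, one_mul, mul_zero] at e2
        exact Int.natCast_modEq_iff.1 (by exact_mod_cast e2)
      · rw [h1, hs, hs0]
        field_simp [theta_ne_zero]
    · have : ∑ i, (a i ^ 2 - a i * b i + b i ^ 2) = 6 := by
        simp [hone]
      rw [this] at hsum
      push_cast at hsum
      linarith

theorem sum_norm_sq_of_mem_vectors {v : Fin 6 → ℂ} (hv : v ∈ vectors) :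
    ∑ i, ‖v i‖ ^ 2 = 2 := by
  have hω : ‖omega‖ = 1 := omega_isPrimitiveRoot.norm'_eq_one (by norm_num)
  rcases mem_vectors.1 hv with ⟨i, j, a, b, hij, rfl⟩ | ⟨s, a, -, rfl⟩
  · rw [← Finset.add_sum_erase _ _ (Finset.mem_univ i), ← Finset.add_sum_erase _ _
      (Finset.mem_erase.2 ⟨hij.symm, Finset.mem_univ j⟩), Finset.sum_eq_zero]
    · simp [hij, hij.symm, hω]
      norm_num
    · intro k hk
      simp only [Finset.mem_erase] at hk
      simp [hk.1, hk.2.1]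
  · have h3 : (‖theta‖ ^ 2)⁻¹ = 1 / 3 := by rw [norm_theta_sq]; norm_num
    have hs : ‖((s : ℤ) : ℂ)‖ = 1 := by
      rcases Int.units_eq_one_or s with rfl | rfl <;> simp
    have h1 : ∀ i, ‖((s : ℤ) : ℂ) * (1 / theta) * omega ^ (a i : ℕ)‖ ^ 2 = 1 / 3 := fun i => by
      rw [norm_mul, norm_mul, norm_pow, hs, hω, one_pow, mul_one, one_mul, one_div, norm_inv,
        inv_pow, h3]
    simp only [h1]
    norm_num

theorem mem_vectors_iff {v : Fin 6 → ℂ} :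
    v ∈ vectors ↔ v ∈ congruenceLattice ∧ ∑ i, ‖v i‖ ^ 2 = 2 := by
  refine ⟨fun h => ⟨vectors_subset_congruenceLattice h, sum_norm_sq_of_mem_vectors h⟩,
    fun h => (minimal_of_mem_congruenceLattice h.1 ?_ h.2.le).1⟩
  rintro rfl
  simpa using h.2

theorem mem_vectors_iff_mem_lattice {v : Fin 6 → ℂ} :
    v ∈ vectors ↔ v ∈ lattice ∧ ∑ i, ‖v i‖ ^ 2 = 2 :=
  ⟨fun h => ⟨Submodule.subset_span h, sum_norm_sq_of_mem_vectors h⟩,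
    fun h => mem_vectors_iff.2 ⟨lattice_subset_congruenceLattice h.1, h.2⟩⟩

theorem two_le_sum_norm_sq {v : Fin 6 → ℂ} (hv : v ∈ lattice) (h0 : v ≠ 0) :
    2 ≤ ∑ i, ‖v i‖ ^ 2 := by
  by_contra! h
  exact h.ne (minimal_of_mem_congruenceLattice (lattice_subset_congruenceLattice hv) h0 h.le).2

end Lattice

/-! ### Invariance of the power sums. -/

section Stability

/-- The linear form `v_1 x_1 + ⋯ + v_6 x_6`. -/
def linearForm (v : Fin 6 → ℂ) : MvPolynomial (Fin 6) ℂ := ∑ i, C (v i) * X i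

/-- Substitution acts on coefficient rows from the right, so a power sum is invariant as soon as its
vectors are permuted by `Matrix.vecMul`. -/
theorem subst_linearForm (A : Matrix (Fin 6) (Fin 6) ℂ) (v : Fin 6 → ℂ) :
    subst A (linearForm v) = linearForm (Matrix.vecMul v A) := by
  simp only [linearForm, map_sum, map_mul, subst_C, subst_X, Matrix.vecMul, dotProduct,
    Finset.mul_sum, Finset.sum_mul]
  rw [Finset.sum_comm]
  exact Finset.sum_congr rfl fun j _ => Finset.sum_congr rfl fun k _ => by ring

theorem vecMul_reflectionMatrix (a v : Fin 6 → ℂ) :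
    Matrix.vecMul v (reflectionMatrix a) = v - (2 / (star a ⬝ᵥ a) * (v ⬝ᵥ a)) • star a := by
  rw [reflectionMatrix, Matrix.vecMul_sub, Matrix.vecMul_one, Matrix.vecMul_smul,
    Matrix.vecMul_vecMulVec, smul_smul]

theorem ofReal_sum_norm_sq (v : Fin 6 → ℂ) : ((∑ i, ‖v i‖ ^ 2 : ℝ) : ℂ) = v ⬝ᵥ star v := by
  push_cast
  exact Finset.sum_congr rfl fun i _ => (Complex.mul_conj' (v i)).symm

theorem conjTranspose_reflectionMatrix (a : Fin 6 → ℂ) :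
    (reflectionMatrix a).conjTranspose = reflectionMatrix a := by
  have h : star (star a ⬝ᵥ a) = star a ⬝ᵥ a := (Matrix.star_dotProduct a a).symm
  rw [reflectionMatrix, Matrix.conjTranspose_sub, Matrix.conjTranspose_one,
    Matrix.conjTranspose_smul, Matrix.conjTranspose_vecMulVec, star_star, star_div₀, h]
  simp

/-- Reflections preserve the norm. -/
theorem sum_norm_sq_vecMul {a : Fin 6 → ℂ} (ha : a ≠ 0) (v : Fin 6 → ℂ) :
    ∑ i, ‖Matrix.vecMul v (reflectionMatrix a) i‖ ^ 2 = ∑ i, ‖v i‖ ^ 2 := by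
  have h : ((∑ i, ‖Matrix.vecMul v (reflectionMatrix a) i‖ ^ 2 : ℝ) : ℂ) =
      ((∑ i, ‖v i‖ ^ 2 : ℝ) : ℂ) := by
    rw [ofReal_sum_norm_sq, ofReal_sum_norm_sq, Matrix.star_vecMul,
      conjTranspose_reflectionMatrix, Matrix.dotProduct_mulVec, Matrix.vecMul_vecMul,
      reflectionMatrix_mul_self ha, Matrix.vecMul_one]
  exact_mod_cast h

theorem vecMul_reflectionMatrix_sub {i j : Fin 6} (hij : i ≠ j) (v : Fin 6 → ℂ) :
    Matrix.vecMul v (reflectionMatrix (Pi.single i 1 - Pi.single j 1)) = v ∘ Equiv.swap i j := by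
  rw [vecMul_reflectionMatrix]
  have h : star (Pi.single i 1 - Pi.single j 1 : Fin 6 → ℂ) = Pi.single i 1 - Pi.single j 1 := by
    rw [star_sub, ← Pi.single_star, ← Pi.single_star, star_one]
  have h2 : (Pi.single i 1 - Pi.single j 1 : Fin 6 → ℂ) ⬝ᵥ (Pi.single i 1 - Pi.single j 1) = 2 := by
    simp [hij, hij.symm]
    norm_num
  rw [h, h2]
  funext k
  by_cases hi : k = i
  · subst hi
    simp [hij]
  · by_cases hj : k = j
    · subst hj
      simp [hij.symm]
    · simp [hi, hj, Equiv.swap_apply_of_ne_of_ne hi hj]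

theorem vecMul_reflectionMatrix_omega (v : Fin 6 → ℂ) :
    Matrix.vecMul v (reflectionMatrix (star ![1, -omega, 0, 0, 0, 0])) =
      ![omega ^ 2 * v 1, omega * v 0, v 2, v 3, v 4, v 5] := by
  rw [vecMul_reflectionMatrix, star_star]
  have h : (![1, -omega, 0, 0, 0, 0] : Fin 6 → ℂ) ⬝ᵥ star ![1, -omega, 0, 0, 0, 0] = 2 := by
    simp only [dotProduct, Fin.sum_univ_six, Pi.star_apply]
    simp [-RCLike.star_def, star_omega]
    linear_combination omega_pow_three
  have h2 : v ⬝ᵥ star ![1, -omega, 0, 0, 0, 0] = v 0 - omega ^ 2 * v 1 := by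
    simp only [dotProduct, Fin.sum_univ_six, Pi.star_apply]
    simp [-RCLike.star_def, star_omega]
    ring
  rw [h, h2]
  funext k
  fin_cases k <;> simp
  linear_combination - v 1 * omega_pow_three

theorem vecMul_reflectionMatrix_one (v : Fin 6 → ℂ) :
    Matrix.vecMul v (reflectionMatrix fun _ => 1) = fun i => v i - (∑ j, v j) / 3 := by
  rw [vecMul_reflectionMatrix]
  funext k
  simp [dotProduct]
  ring

theorem ne_zero_of_mem_normals {a : Fin 6 → ℂ} (ha : a ∈ normals) : a ≠ 0 := by
  rintro rfl
  rcases ha with ⟨i, j, hij, h⟩ | h | h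
  · have := congrFun h i
    simp [hij] at this
  · have := congrFun h 0
    simp at this
  · have := congrFun h 0
    simp at this

/-- The reflections that generate `G₃₄` preserve `congruenceLattice`. -/
theorem vecMul_mem_congruenceLattice {a : Fin 6 → ℂ} (ha : a ∈ normals) {v : Fin 6 → ℂ}
    (hv : v ∈ congruenceLattice) :
    Matrix.vecMul v (reflectionMatrix a) ∈ congruenceLattice := by
  obtain ⟨a, b, h1, h2, h3, h4⟩ := hv
  rcases ha with ⟨i, j, hij, rfl⟩ | rfl | rfl
  · rw [vecMul_reflectionMatrix_sub hij]
    refine ⟨a ∘ Equiv.swap i j, b ∘ Equiv.swap i j, fun k => h1 _, fun k l => h2 _ _, ?_, ?_⟩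
    · simpa only [Function.comp_apply, Equiv.sum_comp] using h3
    · simpa only [Function.comp_apply, Equiv.sum_comp] using h4
  · rw [vecMul_reflectionMatrix_omega]
    -- Modulo 3 the twist changes both coordinate sums by `±((a 1 + b 1) - (a 0 + b 0))`, which the
    -- equality of residues kills.
    have e1 := (h2 0 1).dvd
    refine ⟨![b 1 - a 1, -b 0, a 2, a 3, a 4, a 5], ![-a 1, a 0 - b 0, b 2, b 3, b 4, b 5],
      fun k => ?_, ?_, ?_, ?_⟩
    · have hω : ∀ c d : ℤ, omega ^ 2 * eis c d = eis (d - c) (-c) := fun c d => by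
        rw [pow_two, mul_assoc, omega_mul_eis, omega_mul_eis]
        congr 1 <;> ring
      fin_cases k <;> simp [h1, mul_left_comm theta, omega_mul_eis, hω]
    · have key : ∀ i, ![b 1 - a 1, -b 0, a 2, a 3, a 4, a 5] i +
          ![-a 1, a 0 - b 0, b 2, b 3, b 4, b 5] i ≡ a i + b i [ZMOD 3] := by
        intro i
        fin_cases i <;> simp [Int.modEq_iff_dvd] <;> omega
      exact fun i j => ((key i).trans (h2 i j)).trans (key j).symm
    · rw [Fin.sum_univ_six] at h3 ⊢
      simp
      omega
    · rw [Fin.sum_univ_six] at h4 ⊢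
      simp
      omega
  · rw [vecMul_reflectionMatrix_one]
    obtain ⟨s, hs⟩ := h3
    obtain ⟨t, ht⟩ := h4
    -- The same Eisenstein integer `s + tω` is subtracted from all six coordinates: residues stay
    -- equal, and the sums `3s`, `3t` become `-3s`, `-3t`.
    refine ⟨fun i => a i - s, fun i => b i - t, fun i => ?_, fun i j => ?_, ?_, ?_⟩
    · have h5 : theta * ∑ j, v j = eis (3 * s) (3 * t) := by
        rw [← hs, ← ht, Finset.mul_sum]
        simp only [h1, eis, Finset.sum_add_distrib, Int.cast_sum, Finset.sum_mul]
      rw [mul_sub, mul_div_assoc', h5, h1]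
      simp only [eis]
      push_cast
      ring
    · have e := (h2 i j).dvd
      refine Int.modEq_iff_dvd.2 ?_
      convert e using 1
      ring
    · simp [Finset.sum_sub_distrib, hs]
      omega
    · simp [Finset.sum_sub_distrib, ht]
      omega

/-- No case distinction on vectors is needed, since lattice membership and norm characterise them
and each is preserved. -/
theorem vecMul_mem_vectors {a : Fin 6 → ℂ} (ha : a ∈ normals) {v : Fin 6 → ℂ}
    (hv : v ∈ vectors) : Matrix.vecMul v (reflectionMatrix a) ∈ vectors := by
  rw [mem_vectors_iff] at hv ⊢
  exact ⟨vecMul_mem_congruenceLattice ha hv.1,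
    by rw [sum_norm_sq_vecMul (ne_zero_of_mem_normals ha), hv.2]⟩

theorem vecMul_vecMul_reflectionMatrix {a : Fin 6 → ℂ} (ha : a ∈ normals) (v : Fin 6 → ℂ) :
    Matrix.vecMul (Matrix.vecMul v (reflectionMatrix a)) (reflectionMatrix a) = v := by
  rw [Matrix.vecMul_vecMul, reflectionMatrix_mul_self (ne_zero_of_mem_normals ha),
    Matrix.vecMul_one]

theorem powerSum_mem_invariantRing (n : ℕ) : powerSum n ∈ invariantRing G34 := by
  refine mem_invariantRing_closure ?_
  rintro g ⟨a, ha, hg⟩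
  rw [hg, powerSum, map_sum]
  refine Finset.sum_nbij' (fun v => Matrix.vecMul v (reflectionMatrix a))
    (fun v => Matrix.vecMul v (reflectionMatrix a)) (fun v hv => vecMul_mem_vectors ha hv)
    (fun v hv => vecMul_mem_vectors ha hv) (fun v _ => vecMul_vecMul_reflectionMatrix ha v)
    (fun v _ => vecMul_vecMul_reflectionMatrix ha v) fun v _ => ?_
  rw [map_pow]
  exact congrArg (· ^ n) (subst_linearForm _ v)

theorem isHomogeneous_linearForm (v : Fin 6 → ℂ) : (linearForm v).IsHomogeneous 1 :=
  IsHomogeneous.sum _ _ _ fun _ _ => isHomogeneous_C_mul_X _ _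

theorem isHomogeneous_powerSum (n : ℕ) : (powerSum n).IsHomogeneous n :=
  IsHomogeneous.sum _ _ _ fun v _ => by
    have := (isHomogeneous_linearForm v).pow n
    rwa [one_mul] at this

end Stability

/-! ### Unique parameters for the 756 vectors. -/

section Parametrization

/-- The parameters of the vectors with exactly two nonzero coordinates. -/
def pairParams : Finset (Fin 6 × Fin 6 × Fin 3 × Fin 3) :=
  Finset.univ.filter fun t => t.1 ≠ t.2.1

/-- The exponents of the vectors with six nonzero coordinates. -/
def fullParams : Finset (Fin 6 → Fin 3) :=
  Finset.univ.filter fun a => (∑ i, (a i : ℕ)) ≡ 0 [MOD 3]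

/-- The vectors with two nonzero coordinates. -/
def pairVector (t : Fin 6 × Fin 6 × Fin 3 × Fin 3) : Fin 6 → ℂ :=
  Pi.single t.1 (omega ^ (t.2.2.1 : ℕ)) - Pi.single t.2.1 (omega ^ (t.2.2.2 : ℕ))

/-- The vectors with six nonzero coordinates. -/
def fullVector (s : ℤˣ) (a : Fin 6 → Fin 3) : Fin 6 → ℂ :=
  fun i => ((s : ℤ) : ℂ) * (1 / theta) * omega ^ (a i : ℕ)

theorem omega_pow_injective {a b : Fin 3} (h : omega ^ (a : ℕ) = omega ^ (b : ℕ)) : a = b :=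
  Fin.ext (omega_isPrimitiveRoot.pow_inj a.2 b.2 h)

theorem omega_pow_ne_neg (a b : ℕ) : omega ^ a ≠ -omega ^ b := by
  intro h
  have h1 := congrArg (· ^ 3) h
  simp only [neg_pow (omega ^ b), ← pow_mul, mul_comm _ 3, pow_mul omega 3, omega_pow_three,
    one_pow] at h1
  norm_num at h1

theorem omega_pow_ne_zero (a : ℕ) : omega ^ a ≠ 0 := pow_ne_zero a omega_ne_zero

theorem pairVector_injOn : Set.InjOn pairVector (pairParams : Set _) := by
  rintro ⟨i, j, a, b⟩ h ⟨i', j', a', b'⟩ h' heq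
  have hij : i ≠ j := by simpa [pairParams] using h
  have hij' : i' ≠ j' := by simpa [pairParams] using h'
  simp only [pairVector] at heq
  have h1 := congrFun heq i
  have h2 := congrFun heq j
  have e1 : i = i' ∧ a = a' := by
    by_cases hi : i = i'
    · subst hi
      simp [hij, hij'] at h1
      exact ⟨rfl, omega_pow_injective h1⟩
    · exfalso
      by_cases hj : i = j'
      · subst hj
        simp [hij, hij'.symm] at h1
        exact omega_pow_ne_neg _ _ h1
      · simp [hij, hi, hj, omega_ne_zero] at h1
  have e2 : j = j' ∧ b = b' := by
    by_cases hi : j = j'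
    · subst hi
      simp [hij.symm, hij'.symm] at h2
      exact ⟨rfl, omega_pow_injective h2⟩
    · exfalso
      by_cases hj : j = i'
      · subst hj
        simp [hij.symm, hij'] at h2
        exact omega_pow_ne_neg _ _ h2.symm
      · simp [hij.symm, hi, hj, omega_ne_zero] at h2
  rw [e1.1, e1.2, e2.1, e2.2]

theorem fullVector_injective {s s' : ℤˣ} {a a' : Fin 6 → Fin 3}
    (h : fullVector s a = fullVector s' a') : s = s' ∧ a = a' := by
  have h1 : ∀ i, ((s : ℤ) : ℂ) * omega ^ (a i : ℕ) = ((s' : ℤ) : ℂ) * omega ^ (a' i : ℕ) := by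
    intro i
    have h2 := congrFun h i
    simp only [fullVector] at h2
    field_simp [theta_ne_zero] at h2
    exact h2
  have hs : s = s' := by
    have h2 := h1 0
    rcases Int.units_eq_one_or s with rfl | rfl <;> rcases Int.units_eq_one_or s' with rfl | rfl
    · rfl
    · simp at h2
      exact absurd h2 (omega_pow_ne_neg _ _)
    · simp at h2
      exact absurd h2.symm (omega_pow_ne_neg _ _)
    · rfl
  refine ⟨hs, funext fun i => omega_pow_injective ?_⟩
  have h2 := h1 i
  rw [hs] at h2
  refine mul_left_cancel₀ ?_ h2
  rcases Int.units_eq_one_or s' with rfl | rfl <;> simp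

/-- A sum over `vectors` in terms of the parameters. -/
theorem sum_vectors {M : Type*} [AddCommMonoid M] (F : (Fin 6 → ℂ) → M) :
    ∑ v ∈ vectors, F v = ∑ t ∈ pairParams, F (pairVector t) +
      ∑ s : ℤˣ, ∑ a ∈ fullParams, F (fullVector s a) := by
  classical
  have h : vectors = pairParams.image pairVector ∪
      (Finset.univ ×ˢ fullParams).image fun t => fullVector t.1 t.2 := by
    ext v
    simp only [mem_vectors, Finset.mem_union, Finset.mem_image, pairParams, fullParams,
      Finset.mem_filter, Finset.mem_univ, true_and, Finset.mem_product, Prod.exists, pairVector,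
      eq_comm (a := v)]
    rfl
  have hd : Disjoint (pairParams.image pairVector)
      ((Finset.univ ×ˢ fullParams).image fun t : ℤˣ × _ => fullVector t.1 t.2) := by
    rw [Finset.disjoint_left]
    intro v h1 h2
    obtain ⟨⟨i, j, a, b⟩, -, rfl⟩ := Finset.mem_image.1 h1
    obtain ⟨⟨s, a'⟩, -, h3⟩ := Finset.mem_image.1 h2
    obtain ⟨k, hi, hj⟩ : ∃ k : Fin 6, k ≠ i ∧ k ≠ j := by
      clear h1 h2 h3
      revert i j
      decide
    have h4 := congrFun h3 k
    simp [pairVector, fullVector, hi, hj, omega_ne_zero, theta_ne_zero] at h4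
  rw [h, Finset.sum_union hd, Finset.sum_image pairVector_injOn, Finset.sum_image,
    Finset.sum_product]
  rintro ⟨s, a⟩ - ⟨s', a'⟩ - h
  obtain ⟨rfl, rfl⟩ := fullVector_injective h
  rfl

theorem card_fullParams : fullParams.card = 243 := by
  decide +kernel

theorem card_vectors : vectors.card = 756 := by
  have h1 : pairParams.card = 270 := by decide +kernel
  have h2 := sum_vectors fun _ => 1
  simpa [h1, card_fullParams] using h2

end Parametrization

/-! ### Coefficients of monomial symmetric polynomials and moments of the vectors. -/

section Coefficients

/-- The multiset of nonzero exponents of a monomial. -/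
def shape (s : Fin 6 →₀ ℕ) : Multiset ℕ := s.support.val.map s

theorem pos_of_mem_shape {s : Fin 6 →₀ ℕ} {a : ℕ} (h : a ∈ shape s) : 0 < a := by
  obtain ⟨i, hi, rfl⟩ := Multiset.mem_map.1 h
  exact Nat.pos_of_ne_zero (Finsupp.mem_support_iff.1 hi)

theorem card_shape (s : Fin 6 →₀ ℕ) : (shape s).card = s.support.card :=
  Multiset.card_map _ _

theorem prod_map_X_eq_monomial (t : Multiset (Fin 6)) :
    (t.map X).prod = (monomial (Multiset.toFinsupp t) 1 : MvPolynomial (Fin 6) ℂ) := by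
  induction t using Multiset.induction_on with
  | empty => simp
  | cons a t ih =>
    rw [Multiset.map_cons, Multiset.prod_cons, ih, ← Multiset.singleton_add, map_add,
      Multiset.toFinsupp_singleton, X, monomial_mul, one_mul]

/-- Positivity of the parts matters because `Nat.Partition.ofMultiset` discards zeros. -/
theorem coeff_m {e : Multiset ℕ} (he : ∀ a ∈ e, a ≠ 0) (s : Fin 6 →₀ ℕ) :
    coeff s (m e) = if shape s = e then 1 else 0 := by
  classical
  have hparts : (Nat.Partition.ofMultiset e).parts = e := by
    rw [Nat.Partition.ofMultiset_parts, Multiset.filter_eq_self]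
    exact he
  have hshape : ∀ x : {a : Sym (Fin 6) e.sum //
      Nat.Partition.ofSym a = Nat.Partition.ofMultiset e},
      shape (Multiset.toFinsupp x.1.1) = e := by
    intro x
    exact Eq.trans (congrArg Nat.Partition.parts x.2) hparts
  rw [m, msymm, coeff_sum]
  simp only [prod_map_X_eq_monomial, coeff_monomial]
  split_ifs with h
  · have hsum : (Finsupp.toMultiset s).card = e.sum := by
      rw [Finsupp.card_toMultiset, ← h]
      rfl
    have hof : Nat.Partition.ofSym (⟨Finsupp.toMultiset s, hsum⟩ : Sym (Fin 6) e.sum) =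
        Nat.Partition.ofMultiset e := by
      refine Nat.Partition.ext ?_
      rw [hparts]
      have : shape (Multiset.toFinsupp (Finsupp.toMultiset s)) = e := by
        rw [Finsupp.toMultiset_toFinsupp, h]
      exact this
    rw [Fintype.sum_eq_single ⟨⟨Finsupp.toMultiset s, hsum⟩, hof⟩]
    · simp
    · intro x hx
      rw [if_neg]
      rintro rfl
      refine hx (Subtype.ext (Subtype.ext ?_))
      simp
  · refine Finset.sum_eq_zero fun x _ => if_neg ?_
    rintro rfl
    exact h (hshape x)

theorem multinomialCoeff_shape (s : Fin 6 →₀ ℕ) :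
    multinomialCoeff (shape s) = (s.multinomial : ℂ) := by
  have h : ∏ i ∈ s.support, ((s i)! : ℂ) ≠ 0 :=
    Finset.prod_ne_zero_iff.2 fun i _ => by exact_mod_cast (Nat.factorial_pos _).ne'
  have h2 : ((shape s).map fun a => (a ! : ℂ)).prod = ∏ i ∈ s.support, ((s i)! : ℂ) := by
    rw [shape, Multiset.map_map]
    rfl
  rw [multinomialCoeff, h2, div_eq_iff h, mul_comm, Finsupp.multinomial_eq]
  have h3 := Nat.multinomial_spec s.support s
  exact_mod_cast h3.symm

theorem coeff_linearForm_pow (v : Fin 6 → ℂ) (n : ℕ) (s : Fin 6 →₀ ℕ) :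
    coeff s (linearForm v ^ n) =
      if s.sum (fun _ a => a) = n then (s.multinomial : ℂ) * ∏ i, v i ^ s i else 0 := by
  have h := coeff_linearCombination_X_pow_of_fintype v s n
  rw [Finsupp.prod_fintype _ _ fun i => pow_zero _] at h
  rw [← h, linearForm]
  simp only [smul_eq_C_mul]

theorem sum_omega_pow_mul (n : ℕ) :
    ∑ a : Fin 3, omega ^ ((a : ℕ) * n) = if 3 ∣ n then 3 else 0 := by
  rw [Fin.sum_univ_three]
  obtain ⟨q, r, hr, rfl⟩ : ∃ q r, r < 3 ∧ n = 3 * q + r :=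
    ⟨n / 3, n % 3, Nat.mod_lt _ (by norm_num), (Nat.div_add_mod n 3).symm⟩
  have h : omega ^ (3 * q) = 1 := by rw [pow_mul, omega_pow_three, one_pow]
  have h2 : (3 ∣ 3 * q + r) ↔ r = 0 := by omega
  simp only [Fin.val_zero, Fin.val_one, Fin.val_two, zero_mul, one_mul, pow_zero, pow_mul',
    pow_add, h, h2]
  interval_cases r
  · norm_num
  · simp
    linear_combination omega_sq
  · simp
    linear_combination omega_sq + omega * omega_pow_three

theorem sum_fullParams (s : Fin 6 → ℕ) :
    ∑ a ∈ fullParams, ∏ i, (omega ^ (a i : ℕ)) ^ s i =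
      if ∀ i, s i ≡ s 0 [MOD 3] then 243 else 0 := by
  have h1 : ∀ a : Fin 6 → Fin 3,
      (if (∑ i, (a i : ℕ)) ≡ 0 [MOD 3] then ∏ i, (omega ^ (a i : ℕ)) ^ s i else 0) =
      (1 / 3) * ∑ t : Fin 3, ∏ i, omega ^ ((a i : ℕ) * (s i + t)) := by
    intro a
    have e1 : ∀ t : Fin 3, ∏ i, omega ^ ((a i : ℕ) * (s i + t)) =
        omega ^ ((t : ℕ) * ∑ i, (a i : ℕ)) * ∏ i, (omega ^ (a i : ℕ)) ^ s i := by
      intro t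
      rw [Finset.mul_sum, ← Finset.prod_pow_eq_pow_sum, ← Finset.prod_mul_distrib]
      exact Finset.prod_congr rfl fun i _ => by ring
    simp only [e1, ← Finset.sum_mul, sum_omega_pow_mul, Nat.modEq_zero_iff_dvd]
    split_ifs
    · ring
    · ring
  have h2 : ∀ t : Fin 3, ∑ a : Fin 6 → Fin 3, ∏ i, omega ^ ((a i : ℕ) * (s i + t)) =
      if (∀ i, s i ≡ s 0 [MOD 3]) ∧ 3 ∣ s 0 + t then 729 else 0 := by
    intro t
    have e := Finset.prod_univ_sum (fun _ : Fin 6 => (Finset.univ : Finset (Fin 3)))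
      (fun i c => omega ^ ((c : ℕ) * (s i + t)))
    rw [Fintype.piFinset_univ] at e
    rw [← e]
    simp only [sum_omega_pow_mul, Finset.prod_ite_zero, Finset.prod_const, Finset.card_univ,
      Fintype.card_fin, Finset.mem_univ, true_implies]
    have e2 : (∀ i, 3 ∣ s i + (t : ℕ)) ↔ (∀ i, s i ≡ s 0 [MOD 3]) ∧ 3 ∣ s 0 + (t : ℕ) := by
      constructor
      · intro h
        refine ⟨fun i => Nat.ModEq.add_right_cancel' (t : ℕ) ?_, h 0⟩
        exact (Nat.modEq_zero_iff_dvd.2 (h i)).trans (Nat.modEq_zero_iff_dvd.2 (h 0)).symm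
      · rintro ⟨h, h0⟩ i
        exact Nat.modEq_zero_iff_dvd.1
          (((h i).add_right _).trans (Nat.modEq_zero_iff_dvd.2 h0))
    rw [if_congr e2 rfl rfl]
    norm_num
  rw [fullParams, Finset.sum_filter]
  simp only [h1]
  rw [← Finset.mul_sum, Finset.sum_comm]
  simp only [h2]
  by_cases hc : ∀ i, s i ≡ s 0 [MOD 3]
  · simp only [hc, implies_true, true_and, if_true, Fin.sum_univ_three, Fin.val_zero, Fin.val_one,
      Fin.val_two, Nat.dvd_iff_mod_eq_zero, Nat.add_mod (s 0)]
    have : s 0 % 3 < 3 := Nat.mod_lt _ (by norm_num)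
    interval_cases s 0 % 3 <;> norm_num
  · simp [hc]

theorem theta_pow_six : theta ^ 6 = -27 := by
  rw [show 6 = 2 * 3 from rfl, pow_mul, theta_sq]
  norm_num

/-- In degree `6k` the sign disappears and `√-3` contributes `(-27)^k` to the denominator; the two
signs double 243 to 486. -/
theorem sum_fullVector (k : ℕ) (s : Fin 6 → ℕ) (hs : ∑ i, s i = 6 * k) :
    ∑ σ : ℤˣ, ∑ a ∈ fullParams, ∏ i, fullVector σ a i ^ s i =
      486 / (-27) ^ k * if ∀ i, s i ≡ s 0 [MOD 3] then 1 else 0 := by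
  have h : ∀ (σ : ℤˣ) (a : Fin 6 → Fin 3), ∏ i, fullVector σ a i ^ s i =
      1 / (-27) ^ k * ∏ i, (omega ^ (a i : ℕ)) ^ s i := by
    intro σ a
    simp only [fullVector, mul_pow _ (omega ^ _), Finset.prod_mul_distrib]
    rw [Finset.prod_pow_eq_pow_sum, hs, mul_pow, div_pow, one_pow, pow_mul theta, theta_pow_six]
    rcases Int.units_eq_one_or σ with rfl | rfl
    · simp
    · simp [pow_mul, Even.neg_one_pow (show Even 6 by decide)]
  simp only [h, ← Finset.mul_sum, sum_fullParams]
  simp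
  exact if_congr Iff.rfl (by ring) rfl

/-- The contribution of the vectors supported on a pair of coordinates. -/
theorem sum_pairVector_pair {i j : Fin 6} (hij : i ≠ j) (s : Fin 6 → ℕ) :
    ∑ a : Fin 3, ∑ b : Fin 3, ∏ l, pairVector (i, j, a, b) l ^ s l =
      if (∀ l, l ≠ i → l ≠ j → s l = 0) ∧ 3 ∣ s i ∧ 3 ∣ s j then 9 * (-1) ^ s j else 0 := by
  have h : ∀ a b : Fin 3, ∏ l, pairVector (i, j, a, b) l ^ s l =
      if ∀ l, l ≠ i → l ≠ j → s l = 0 then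
        omega ^ ((a : ℕ) * s i) * ((-1) ^ s j * omega ^ ((b : ℕ) * s j)) else 0 := by
    intro a b
    rw [← Finset.mul_prod_erase _ _ (Finset.mem_univ i), ← Finset.mul_prod_erase _ _
      (Finset.mem_erase.2 ⟨hij.symm, Finset.mem_univ j⟩)]
    have h1 : ∏ l ∈ (Finset.univ.erase i).erase j, pairVector (i, j, a, b) l ^ s l =
        if ∀ l, l ≠ i → l ≠ j → s l = 0 then 1 else 0 := by
      have h2 : ∀ l ∈ (Finset.univ.erase i).erase j, pairVector (i, j, a, b) l ^ s l =
          if s l = 0 then 1 else 0 := by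
        intro l hl
        simp only [Finset.mem_erase, Finset.mem_univ, and_true] at hl
        simp [pairVector, hl.1, hl.2, zero_pow_eq]
      rw [Finset.prod_congr rfl h2]
      split_ifs with hc
      · refine Finset.prod_eq_one fun l hl => if_pos ?_
        simp only [Finset.mem_erase, Finset.mem_univ, and_true] at hl
        exact hc l hl.2 hl.1
      · push Not at hc
        obtain ⟨l, hi, hj, hl⟩ := hc
        exact Finset.prod_eq_zero (i := l) (by simp [hi, hj]) (if_neg hl)
    rw [h1]
    simp only [pairVector, Pi.sub_apply, Pi.single_eq_same, Pi.single_eq_of_ne hij,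
      Pi.single_eq_of_ne hij.symm, sub_zero, zero_sub, neg_pow (omega ^ _), pow_mul]
    split_ifs
    · ring
    · rw [mul_zero, mul_zero]
  simp only [h]
  by_cases hc : ∀ l, l ≠ i → l ≠ j → s l = 0
  · simp only [if_pos hc, ← Finset.mul_sum, ← Finset.sum_mul, sum_omega_pow_mul]
    by_cases hi : 3 ∣ s i
    · by_cases hj : 3 ∣ s j
      · rw [if_pos hi, if_pos hj, if_pos ⟨hc, hi, hj⟩]
        ring
      · rw [if_neg hj, if_neg fun h : _ ∧ _ ∧ _ => hj h.2.2]
        ring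
    · rw [if_neg hi, if_neg fun h : _ ∧ _ ∧ _ => hi h.2.1]
      ring
  · simp only [if_neg hc, if_neg fun h : _ ∧ _ => hc h.1, Finset.sum_const_zero]

theorem sum_pairVector (s : Fin 6 → ℕ) :
    ∑ t ∈ pairParams, ∏ l, pairVector t l ^ s l = ∑ i, ∑ j,
      if i ≠ j ∧ (∀ l, l ≠ i → l ≠ j → s l = 0) ∧ 3 ∣ s i ∧ 3 ∣ s j
        then 9 * (-1) ^ s j else 0 := by
  rw [pairParams, Finset.sum_filter, Fintype.sum_prod_type]
  refine Finset.sum_congr rfl fun i _ => ?_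
  rw [Fintype.sum_prod_type]
  refine Finset.sum_congr rfl fun j _ => ?_
  rw [Fintype.sum_prod_type]
  by_cases hij : i = j
  · simp [hij]
  · simp only [ne_eq, hij, not_false_eq_true, if_true, true_and]
    exact sum_pairVector_pair hij s

end Coefficients

/-! ### The closed formula, by the number of variables in a monomial. -/

section Formula

theorem coeff_powerSum (k : ℕ) {s : Fin 6 →₀ ℕ} (hs : (s.sum fun _ a => a) = 6 * k) :
    coeff s (powerSum (6 * k)) = (s.multinomial : ℂ) *
      (∑ t ∈ pairParams, ∏ l, pairVector t l ^ s l +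
        486 / (-27) ^ k * if ∀ i, s i ≡ s 0 [MOD 3] then 1 else 0) := by
  have hs' : ∑ i, s i = 6 * k := by
    rw [← hs, Finsupp.sum_fintype _ _ fun _ => rfl]
  have h : powerSum (6 * k) = ∑ v ∈ vectors, linearForm v ^ (6 * k) := rfl
  rw [h, coeff_sum]
  simp only [coeff_linearForm_pow, if_pos hs]
  rw [← Finset.mul_sum, sum_vectors fun v => ∏ i, v i ^ s i, sum_fullVector k s hs']

theorem coeff_f (k : ℕ) (hk : 1 ≤ k) (s : Fin 6 →₀ ℕ) :
    coeff s (f k) = (if shape s = {6 * k} then 1 + (-1 : ℂ) ^ k * 27 ^ (k - 1) * 5 else 0) +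
      (∑ t ∈ Finset.Icc 1 k, if shape s = {6 * k - 3 * t, 3 * t} then
        ((6 * k).choose (3 * t) : ℂ) * (1 + (-1 : ℂ) ^ (k + t) * 27 ^ (k - 1)) else 0) +
      ∑ e ∈ admissible k, if shape s = e.parts then (s.multinomial : ℂ) else 0 := by
  rw [f, coeff_add, coeff_add, coeff_sum, coeff_sum, coeff_smul, coeff_m (by simp; omega)]
  congr 1
  · congr 1
    · simp
    · refine Finset.sum_congr rfl fun t ht => ?_
      have ht' := Finset.mem_Icc.1 ht
      rw [coeff_smul, coeff_m]
      · simp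
      · intro a ha
        simp only [Multiset.insert_eq_cons, Multiset.mem_cons, Multiset.mem_singleton] at ha
        omega
  · refine Finset.sum_congr rfl fun e _ => ?_
    rw [coeff_smul, coeff_m fun a ha => (e.parts_pos ha).ne']
    split_ifs with h
    · rw [← h, multinomialCoeff_shape, smul_eq_mul, mul_one]
    · rw [smul_zero]

theorem card_support_le (s : Fin 6 →₀ ℕ) : s.support.card ≤ 6 := by
  simpa using Finset.card_le_univ s.support

/-- The admissible shapes are those of the monomials with congruent exponents. -/
theorem congruent_iff (s : Fin 6 →₀ ℕ) : (∀ i, s i ≡ s 0 [MOD 3]) ↔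
    (∀ a ∈ shape s, ∀ b ∈ shape s, a ≡ b [MOD 3]) ∧
      ((shape s).card < 6 → ∀ a ∈ shape s, a ≡ 0 [MOD 3]) := by
  have hmem : ∀ a, a ∈ shape s ↔ ∃ i, s i ≠ 0 ∧ s i = a := by
    intro a
    simp [shape]
  rw [card_shape]
  simp only [hmem, forall_exists_index, and_imp]
  constructor
  · intro h
    refine ⟨?_, ?_⟩
    · rintro _ i - rfl _ j - rfl
      exact (h i).trans (h j).symm
    · rintro hc _ i - rfl
      obtain ⟨l, hl⟩ : ∃ l, l ∉ s.support := by
        by_contra! hall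
        rw [Finset.eq_univ_iff_forall.2 hall] at hc
        simp at hc
      have := (h i).trans (h l).symm
      rwa [Finsupp.notMem_support_iff.1 hl] at this
  · rintro ⟨h1, h2⟩ i
    by_cases hc : s.support.card < 6
    · have h3 : ∀ j, s j ≡ 0 [MOD 3] := by
        intro j
        by_cases hj : s j = 0
        · rw [hj]
        · exact h2 hc _ j hj rfl
      exact (h3 i).trans (h3 0).symm
    · have hu : s.support = Finset.univ := by
        refine Finset.eq_univ_of_card _ ?_
        have := card_support_le s
        rw [Fintype.card_fin]
        omega
      have h3 : ∀ j, s j ≠ 0 := fun j => Finsupp.mem_support_iff.1 (by rw [hu]; simp)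
      exact h1 _ i (h3 i) rfl _ 0 (h3 0) rfl

theorem sum_admissible (k : ℕ) (s : Fin 6 →₀ ℕ) (hs : (s.sum fun _ a => a) = 6 * k) :
    ∑ e ∈ admissible k, (if shape s = e.parts then (s.multinomial : ℂ) else 0) =
      if 3 ≤ s.support.card ∧ ∀ i, s i ≡ s 0 [MOD 3] then (s.multinomial : ℂ) else 0 := by
  -- Viewing the shape of `s` as a partition of `6k` reduces the sum to one possible term.
  let P : Nat.Partition (6 * k) := ⟨shape s, pos_of_mem_shape, hs⟩
  have h : ∀ e : Nat.Partition (6 * k), shape s = e.parts ↔ P = e := fun e =>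
    ⟨fun h => Nat.Partition.ext h, fun h => h ▸ rfl⟩
  simp only [h, Finset.sum_ite_eq]
  refine if_congr ?_ rfl rfl
  have h6 : s.support.card ≤ 6 := card_support_le s
  rw [congruent_iff, admissible, Finset.mem_filter]
  have hP : P.parts = shape s := rfl
  rw [hP, card_shape]
  simp [h6]

theorem neg_twentySeven_pow (k : ℕ) (hk : 1 ≤ k) :
    (-27 : ℂ) ^ k = (-1) ^ k * 27 ^ (k - 1) * 27 := by
  obtain ⟨j, rfl⟩ := Nat.exists_eq_add_of_le' hk
  rw [Nat.add_sub_cancel, neg_pow, pow_succ 27 j]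
  ring

theorem coeff_eq_of_card_one (k : ℕ) (hk : 1 ≤ k) {s : Fin 6 →₀ ℕ} {p : Fin 6}
    (hs : (s.sum fun _ a => a) = 6 * k) (hp : s.support = {p}) :
    coeff s (f k) = (-27) ^ k / 486 * coeff s (powerSum (6 * k)) := by
  have hsp : s p = 6 * k := by rw [← hs, Finsupp.sum, hp, Finset.sum_singleton]
  have hs0 : ∀ i, i ≠ p → s i = 0 := fun i hi => by
    rw [← Finsupp.notMem_support_iff, hp]
    simpa using hi
  have hshape : shape s = {6 * k} := by rw [shape, hp, ← hsp]; rfl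
  have h3 : ∀ i, 3 ∣ s i := fun i => by
    by_cases hi : i = p
    · rw [hi, hsp]
      omega
    · rw [hs0 i hi]
      exact dvd_zero 3
  have hcong : ∀ i, s i ≡ s 0 [MOD 3] := fun i =>
    (Nat.modEq_zero_iff_dvd.2 (h3 i)).trans (Nat.modEq_zero_iff_dvd.2 (h3 0)).symm
  have heven : ∀ i, (-1 : ℂ) ^ s i = 1 := fun i => by
    by_cases hi : i = p
    · rw [hi, hsp]
      exact Even.neg_one_pow ⟨3 * k, by ring⟩
    · rw [hs0 i hi, pow_zero]
  have hmult : s.multinomial = 1 := by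
    rw [Finsupp.multinomial_eq, hp, Nat.multinomial_singleton]
  have hpair : ∑ t ∈ pairParams, ∏ l, pairVector t l ^ s l = 90 := by
    rw [sum_pairVector]
    have h : ∀ i j, (if i ≠ j ∧ (∀ l, l ≠ i → l ≠ j → s l = 0) ∧ 3 ∣ s i ∧ 3 ∣ s j
        then 9 * (-1 : ℂ) ^ s j else 0) =
        ((if i ≠ j ∧ (p = i ∨ p = j) then 9 else 0 : ℕ) : ℂ) := by
      intro i j
      rw [heven, Nat.cast_ite]
      refine if_congr ?_ (by norm_num) (by norm_num)
      refine and_congr_right fun _ => ⟨fun h => ?_, fun h => ⟨fun l hi hj => hs0 l ?_, h3 i, h3 j⟩⟩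
      · by_contra! hc
        have := h.1 p hc.1 hc.2
        omega
      · rcases h with rfl | rfl <;> assumption
    simp only [h]
    -- Ten ordered pairs contain `p`, each contributing 9; the ratio `90 / 486 = 5 / 27` is the
    -- source of the factor `27^(k-1)·5` in `f`.
    have h2 : ∀ p : Fin 6, ∑ i : Fin 6, ∑ j : Fin 6,
        (if i ≠ j ∧ (p = i ∨ p = j) then 9 else 0 : ℕ) = 90 := by decide
    exact_mod_cast h2 p
  rw [coeff_powerSum k hs, coeff_f k hk, sum_admissible k s hs, hpair, hmult, if_pos hcong, hshape,
    if_pos rfl, hp, Finset.sum_eq_zero, if_neg (by simp), neg_twentySeven_pow k hk]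
  · have h1 : (-1 : ℂ) ^ k ≠ 0 := pow_ne_zero _ (by norm_num)
    field_simp
    norm_num
    ring
  · intro t _
    rw [if_neg]
    intro h
    have := congrArg Multiset.card h
    simp at this

theorem coeff_eq_of_card_two (k : ℕ) (hk : 1 ≤ k) {s : Fin 6 →₀ ℕ} {p q : Fin 6} (hpq : p ≠ q)
    (hs : (s.sum fun _ a => a) = 6 * k) (hsupp : s.support = {p, q}) :
    coeff s (f k) = (-27) ^ k / 486 * coeff s (powerSum (6 * k)) := by
  have hspq : s p + s q = 6 * k := by rw [← hs, Finsupp.sum, hsupp, Finset.sum_pair hpq]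
  have hs0 : ∀ i, i ≠ p → i ≠ q → s i = 0 := fun i hi hj => by
    rw [← Finsupp.notMem_support_iff, hsupp]
    simp [hi, hj]
  have hp0 : s p ≠ 0 := by
    rw [← Finsupp.mem_support_iff, hsupp]
    simp
  have hq0 : s q ≠ 0 := by
    rw [← Finsupp.mem_support_iff, hsupp]
    simp
  have hshape : shape s = {s p, s q} := by
    rw [shape, hsupp, Finset.insert_val_of_notMem (by simpa using hpq), Multiset.map_cons]
    rfl
  have hmult : s.multinomial = (6 * k).choose (s p) := by
    rw [Finsupp.multinomial_eq, hsupp, Nat.binomial_eq_choose hpq, hspq]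
  have hiff : ∀ t ∈ Finset.Icc 1 k,
      shape s = {6 * k - 3 * t, 3 * t} ↔ s p = 3 * t ∨ s q = 3 * t := by
    intro t ht
    have ht' := Finset.mem_Icc.1 ht
    rw [hshape]
    constructor
    · intro h
      have h1 : 3 * t ∈ ({s p, s q} : Multiset ℕ) := by
        rw [h]
        simp
      simp only [Multiset.insert_eq_cons, Multiset.mem_cons, Multiset.mem_singleton] at h1
      omega
    · rintro (h | h)
      · rw [h, show s q = 6 * k - 3 * t by omega, Multiset.pair_comm]
      · rw [h, show s p = 6 * k - 3 * t by omega]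
  have hcong : (∀ i, s i ≡ s 0 [MOD 3]) ↔ 3 ∣ s p := by
    constructor
    · intro h
      obtain ⟨l, h1, h2⟩ : ∃ l : Fin 6, l ≠ p ∧ l ≠ q := by
        clear * - p q
        revert p q
        decide
      have h3 := (h p).trans (h l).symm
      rw [hs0 l h1 h2] at h3
      exact Nat.modEq_zero_iff_dvd.1 h3
    · intro h
      have h3 : ∀ i, s i ≡ 0 [MOD 3] := by
        intro i
        rw [Nat.modEq_zero_iff_dvd]
        by_cases h1 : i = p
        · rwa [h1]
        by_cases h2 : i = q
        · rw [h2]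
          omega
        rw [hs0 i h1 h2]
        exact dvd_zero 3
      exact fun i => (h3 i).trans (h3 0).symm
  -- Both orders of the pair contribute `9 (-1)^(s p)`, as `s p + s q` is even; the ratio `18 / 486
  -- = 1 / 27` explains the power `27^(k-1)`.
  have hpair : ∑ t ∈ pairParams, ∏ l, pairVector t l ^ s l =
      if 3 ∣ s p then 18 * (-1) ^ s p else 0 := by
    rw [sum_pairVector]
    have hsign : (-1 : ℂ) ^ s q = (-1) ^ s p := by
      have : (-1 : ℂ) ^ s q * (-1) ^ s p * (-1) ^ s p = (-1) ^ s p := by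
        rw [← pow_add, add_comm, hspq, Even.neg_one_pow ⟨3 * k, by ring⟩, one_mul]
      rw [← this, mul_assoc, ← pow_add, Even.neg_one_pow ⟨s p, rfl⟩, mul_one]
    have hdvd : 3 ∣ s q ↔ 3 ∣ s p := by omega
    have h : ∀ i j, (if i ≠ j ∧ (∀ l, l ≠ i → l ≠ j → s l = 0) ∧ 3 ∣ s i ∧ 3 ∣ s j
        then 9 * (-1 : ℂ) ^ s j else 0) =
        (if i = p then if j = q then if 3 ∣ s p then 9 * (-1) ^ s p else 0 else 0 else 0) +
        (if i = q then if j = p then if 3 ∣ s p then 9 * (-1) ^ s p else 0 else 0 else 0) := by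
      intro i j
      by_cases h1 : i = p ∧ j = q
      · obtain ⟨rfl, rfl⟩ := h1
        simp only [ne_eq, hpq, not_false_eq_true, true_and, if_true, if_false, add_zero, hsign]
        exact if_congr ⟨fun h => h.2.1, fun h => ⟨hs0, h, hdvd.2 h⟩⟩ rfl rfl
      by_cases h2 : i = q ∧ j = p
      · obtain ⟨rfl, rfl⟩ := h2
        simp only [ne_eq, hpq.symm, not_false_eq_true, true_and, if_true, if_false, zero_add]
        exact if_congr ⟨fun h => h.2.2, fun h => ⟨fun l h1 h2 => hs0 l h2 h1, hdvd.2 h, h⟩⟩ rfl rfl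
      rw [if_neg]
      · split_ifs <;> simp_all
      · rintro ⟨hij, hc, -, -⟩
        have e1 : p = i ∨ p = j := by
          by_contra! hcc
          exact hp0 (hc p hcc.1 hcc.2)
        have e2 : q = i ∨ q = j := by
          by_contra! hcc
          exact hq0 (hc q hcc.1 hcc.2)
        rcases e1 with rfl | rfl <;> rcases e2 with rfl | rfl <;> simp_all
    simp only [h, Finset.sum_add_distrib, Finset.sum_ite_irrel, Finset.sum_ite_eq',
      Finset.mem_univ, if_true, Finset.sum_const_zero]
    split_ifs
    · ring
    · ring
  have hnc : ¬3 ≤ s.support.card := by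
    rw [hsupp, Finset.card_pair hpq]
    omega
  have hne : shape s ≠ {6 * k} := by
    intro h
    have := congrArg Multiset.card h
    rw [hshape] at this
    simp at this
  rw [coeff_powerSum k hs, coeff_f k hk, sum_admissible k s hs, hpair, hmult, if_neg hne,
    if_neg fun h : _ ∧ _ => hnc h.1, zero_add, add_zero,
    Finset.sum_congr rfl fun t ht => if_congr (hiff t ht) rfl rfl,
    if_congr hcong rfl rfl]
  by_cases hdvd : 3 ∣ s p
  · obtain ⟨x, hx⟩ := hdvd
    obtain ⟨y, hy⟩ : 3 ∣ s q := by omega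
    -- With `x + y = 2k`, the formula lists each two-part shape once, by its smaller part; hence the
    -- index `min x y`, which has the parity of `x`.
    have hch : (6 * k).choose (s p) = (6 * k).choose (3 * min x y) := by
      rcases le_total x y with h | h
      · rw [min_eq_left h, hx]
      · rw [min_eq_right h, ← hy]
        exact Nat.choose_symm_of_eq_add hspq.symm
    have hsg : (-1 : ℂ) ^ s p = (-1) ^ min x y := by
      rw [hx, pow_mul, show (-1 : ℂ) ^ 3 = -1 by norm_num]
      rcases le_total x y with h | h
      · rw [min_eq_left h]
      · rw [min_eq_right h, show x = y + 2 * (k - y) by omega, pow_add, pow_mul]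
        norm_num
    rw [if_pos ⟨x, hx⟩, if_pos ⟨x, hx⟩, hch, hsg, Finset.sum_eq_single (min x y), if_pos,
      neg_twentySeven_pow k hk, pow_add]
    · have h1 : (-1 : ℂ) ^ k ≠ 0 := pow_ne_zero _ (by norm_num)
      field_simp
      ring
    · rcases le_total x y with h | h
      · left
        rw [min_eq_left h, hx]
      · right
        rw [min_eq_right h, hy]
    · intro t ht hne
      have ht' := Finset.mem_Icc.1 ht
      refine if_neg ?_
      omega
    · intro h
      rw [Finset.mem_Icc] at h
      omega
  · rw [if_neg hdvd, if_neg hdvd, Finset.sum_eq_zero]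
    · simp
    · intro t _
      refine if_neg ?_
      omega

/-- Pair vectors contribute nothing here, and the normalisation cancels `486/(-27)^k`, leaving the
plain multinomial coefficient. -/
theorem coeff_eq_of_three_le_card (k : ℕ) (hk : 1 ≤ k) {s : Fin 6 →₀ ℕ}
    (hs : (s.sum fun _ a => a) = 6 * k) (hcard : 3 ≤ s.support.card) :
    coeff s (f k) = (-27) ^ k / 486 * coeff s (powerSum (6 * k)) := by
  have hpair : ∑ t ∈ pairParams, ∏ l, pairVector t l ^ s l = 0 := by
    rw [sum_pairVector]
    refine Finset.sum_eq_zero fun i _ => Finset.sum_eq_zero fun j _ => if_neg ?_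
    rintro ⟨-, h, -⟩
    have h1 : s.support ⊆ {i, j} := by
      intro l hl
      by_contra hc
      simp only [Finset.mem_insert, Finset.mem_singleton, not_or] at hc
      exact Finsupp.mem_support_iff.1 hl (h l hc.1 hc.2)
    have := (Finset.card_le_card h1).trans Finset.card_le_two
    omega
  have hne : ∀ e : Multiset ℕ, e.card ≤ 2 → shape s ≠ e := by
    rintro e he rfl
    rw [card_shape] at he
    omega
  rw [coeff_powerSum k hs, coeff_f k hk, sum_admissible k s hs, hpair, if_neg (hne _ (by simp)),
    Finset.sum_eq_zero fun t _ => if_neg (hne _ (by simp))]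
  have h1 : (-27 : ℂ) ^ k ≠ 0 := pow_ne_zero _ (by norm_num)
  by_cases hc : ∀ i, s i ≡ s 0 [MOD 3]
  · rw [if_pos ⟨hcard, hc⟩, if_pos hc]
    field_simp
    ring
  · rw [if_neg fun h => hc h.2, if_neg hc]
    simp

theorem coeff_f_of_degree_ne (k : ℕ) (hk : 1 ≤ k) {s : Fin 6 →₀ ℕ}
    (hs : (s.sum fun _ a => a) ≠ 6 * k) : coeff s (f k) = 0 := by
  have hne : ∀ e : Multiset ℕ, e.sum = 6 * k → shape s ≠ e := by
    rintro e he rfl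
    exact hs he
  rw [coeff_f k hk, if_neg (hne _ (by simp)), Finset.sum_eq_zero, Finset.sum_eq_zero]
  · simp
  · intro e _
    exact if_neg (hne _ e.parts_sum)
  · intro t ht
    have := Finset.mem_Icc.1 ht
    refine if_neg (hne _ ?_)
    simp
    omega

/-- The closed formula for the power sums. -/
theorem f_eq_smul_powerSum (k : ℕ) (hk : 1 ≤ k) :
    f k = ((-27 : ℂ) ^ k / 486) • powerSum (6 * k) := by
  ext s
  rw [coeff_smul, smul_eq_mul]
  by_cases hs : (s.sum fun _ a => a) = 6 * k
  · rcases Nat.lt_or_ge s.support.card 3 with h | h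
    · interval_cases hc : s.support.card
      · rw [Finset.card_eq_zero] at hc
        rw [Finsupp.sum, hc, Finset.sum_empty] at hs
        omega
      · obtain ⟨p, hp⟩ := Finset.card_eq_one.1 hc
        exact coeff_eq_of_card_one k hk hs hp
      · obtain ⟨p, q, hpq, h⟩ := Finset.card_eq_two.1 hc
        exact coeff_eq_of_card_two k hk hpq hs h
    · exact coeff_eq_of_three_le_card k hk hs h
  · rw [coeff_f_of_degree_ne k hk hs, (isHomogeneous_powerSum _).coeff_eq_zero, mul_zero]
    exact hs

end Formula

/-! ### Nonvanishing of the Jacobian by reduction modulo 43. -/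

section Nonvanishing

/-- A point outside all reflecting hyperplanes. -/
def basePoint : Fin 6 → ℕ := ![15, 3, 25, 7, 23, 38]

/-- The sum which for `w = ω`, `u = -1` and `c = -27` is proportional to the value of
`∂ f_{6k} / ∂ x_j` at `basePoint`. -/
def gradSum {R : Type*} [CommSemiring R] (w u c : R) (k : ℕ) (j : Fin 6) : R :=
  c ^ k * ∑ t ∈ pairParams, ((if j = t.1 then w ^ (t.2.2.1 : ℕ) else 0) +
      if j = t.2.1 then u * w ^ (t.2.2.2 : ℕ) else 0) *
      (w ^ (t.2.2.1 : ℕ) * basePoint t.1 + u * w ^ (t.2.2.2 : ℕ) * basePoint t.2.1) ^ (6 * k - 1) +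
    2 * ∑ a ∈ fullParams, w ^ (a j : ℕ) * (∑ i, w ^ (a i : ℕ) * basePoint i) ^ (6 * k - 1)

/-- This moves one expression between `ℕ`, where it is computed, `ZMod 43`, and `ℤ[X]`, which
specialises both to `ω` and to a root modulo 43. -/
theorem map_gradSum {R S : Type*} [CommSemiring R] [CommSemiring S] (F : R →+* S) (w u c : R)
    (k : ℕ) (j : Fin 6) : F (gradSum w u c k j) = gradSum (F w) (F u) (F c) k j := by
  have h : F 2 = 2 := map_ofNat F 2
  simp [gradSum, map_sum, apply_ite F, h]

theorem eval_pderiv_powerSum (x : Fin 6 → ℂ) (n : ℕ) (j : Fin 6) :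
    eval x (pderiv j (powerSum n)) =
      n * ∑ v ∈ vectors, v j * (∑ i, v i * x i) ^ (n - 1) := by
  have h : powerSum n = ∑ v ∈ vectors, linearForm v ^ n := rfl
  rw [h, map_sum, map_sum, Finset.mul_sum]
  refine Finset.sum_congr rfl fun v _ => ?_
  have h1 : pderiv j (linearForm v) = C (v j) := by
    simp [linearForm, pderiv_X, Pi.single_apply]
  have h2 : eval x (linearForm v) = ∑ i, v i * x i := by simp [linearForm]
  rw [pderiv_pow, h1, map_mul, map_mul, map_pow, h2, eval_C, map_natCast]
  ring

theorem eval_pderiv_f (k : ℕ) (hk : 1 ≤ k) (j : Fin 6) :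
    eval (fun i => (basePoint i : ℂ)) (pderiv j (f k)) =
      6 * k / 486 * gradSum omega (-1) (-27) k j := by
  have h1 : ∀ t ∈ pairParams, pairVector t j * (∑ i, pairVector t i * (basePoint i : ℂ)) ^
      (6 * k - 1) = ((if j = t.1 then omega ^ (t.2.2.1 : ℕ) else 0) +
      if j = t.2.1 then -1 * omega ^ (t.2.2.2 : ℕ) else 0) *
      (omega ^ (t.2.2.1 : ℕ) * basePoint t.1 + -1 * omega ^ (t.2.2.2 : ℕ) * basePoint t.2.1) ^
        (6 * k - 1) := by
    intro t _
    congr 1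
    · simp only [pairVector, Pi.sub_apply, Pi.single_apply, sub_eq_add_neg]
      split_ifs <;> simp
    · congr 1
      simp only [pairVector, Pi.sub_apply, Pi.single_apply, sub_mul, ite_mul, zero_mul,
        Finset.sum_sub_distrib, Finset.sum_ite_eq', Finset.mem_univ, if_true]
      ring
  have h2 : ∀ (σ : ℤˣ) (a : Fin 6 → Fin 3), fullVector σ a j *
      (∑ i, fullVector σ a i * (basePoint i : ℂ)) ^ (6 * k - 1) =
      1 / (-27) ^ k * (omega ^ (a j : ℕ) *
        (∑ i, omega ^ (a i : ℕ) * basePoint i) ^ (6 * k - 1)) := by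
    intro σ a
    have e : (((σ : ℤ) : ℂ) * (1 / theta)) ^ (6 * k) = 1 / (-27) ^ k := by
      rw [mul_pow, div_pow, one_pow, pow_mul theta, theta_pow_six]
      rcases Int.units_eq_one_or σ with rfl | rfl
      · simp
      · simp [pow_mul, Even.neg_one_pow (show Even 6 by decide)]
    rw [← e]
    simp only [fullVector, mul_assoc _ (omega ^ _), ← Finset.mul_sum, mul_pow _ (Finset.sum _ _)]
    conv_rhs => rw [show 6 * k = 6 * k - 1 + 1 by omega, pow_succ]
    rw [show 6 * k - 1 + 1 - 1 = 6 * k - 1 by omega]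
    ring
  rw [f_eq_smul_powerSum k hk, Derivation.map_smul, smul_eval, eval_pderiv_powerSum, sum_vectors,
    Finset.sum_congr rfl h1]
  simp only [h2, ← Finset.mul_sum]
  have h3 : (-27 : ℂ) ^ k ≠ 0 := pow_ne_zero _ (by norm_num)
  rw [gradSum, Finset.sum_const, Finset.card_univ, Fintype.card_units_int]
  push_cast
  field_simp
  ring

/-- The values of `gradSum` at the primitive cube root of unity `6` modulo `43`. -/
def gradientMatrix : Matrix (Fin 6) (Fin 6) ℕ :=
  !![29, 37, 4, 1, 25, 22; 22, 19, 5, 32, 31, 6; 10, 32, 8, 19, 12, 42; 7, 33, 35, 17, 3, 4;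
    22, 28, 10, 12, 21, 14; 34, 15, 2, 35, 19, 3]

/-- The inverse of `gradientMatrix` modulo `43`. -/
def gradientMatrixInv : Matrix (Fin 6) (Fin 6) (ZMod 43) :=
  !![11, 30, 30, 29, 33, 35; 10, 18, 16, 32, 7, 7; 5, 23, 1, 7, 17, 1; 27, 19, 31, 23, 3, 2;
    18, 37, 15, 10, 4, 25; 38, 16, 40, 35, 21, 17]

/-- The numbers `k` for which `f_{6k}` is one of the generators. -/
def generatorIndex : Fin 6 → ℕ := ![1, 2, 3, 4, 5, 7]

-- Modulo 43 the naturals 6, 42 and 16 represent `ω`, `-1` and `-27`; indeed `6² + 6 + 1 = 43`.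
set_option maxRecDepth 100000 in
theorem gradSum_mod :
    (fun i j : Fin 6 => gradSum (6 : ℕ) 42 16 (generatorIndex i) j % 43) =
      fun i j => gradientMatrix i j := by
  decide +kernel

theorem det_gradSum_zmod_ne_zero :
    (Matrix.of fun i j => gradSum (6 : ZMod 43) (-1) (-27) (generatorIndex i) j).det ≠ 0 := by
  have h : (Matrix.of fun i j => gradSum (6 : ZMod 43) (-1) (-27) (generatorIndex i) j) =
      gradientMatrix.map (Nat.cast : ℕ → ZMod 43) := by
    ext i j
    have h1 := map_gradSum (Nat.castRingHom (ZMod 43)) 6 42 16 (generatorIndex i) j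
    have h2 : (Nat.castRingHom (ZMod 43)) 6 = 6 := rfl
    have h3 : (Nat.castRingHom (ZMod 43)) 42 = -1 := rfl
    have h4 : (Nat.castRingHom (ZMod 43)) 16 = -27 := rfl
    rw [h2, h3, h4] at h1
    rw [Matrix.of_apply, ← h1, Matrix.map_apply, ← congrFun (congrFun gradSum_mod i) j,
      ZMod.natCast_mod]
    rfl
  rw [h]
  -- An explicit inverse certifies that the determinant is nonzero, so no determinant is expanded.
  have h5 : gradientMatrix.map (Nat.cast : ℕ → ZMod 43) * gradientMatrixInv = 1 := by
    decide +kernel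
  intro h0
  have h6 := congrArg Matrix.det h5
  rw [Matrix.det_mul, h0, zero_mul, Matrix.det_one] at h6
  exact absurd h6 (by decide)

theorem eval₂_det_gradSum {S : Type} [CommRing S] (w : S) (d : Fin 6 → ℕ) :
    Polynomial.eval₂RingHom (Int.castRingHom S) w
      (Matrix.of fun i j => gradSum Polynomial.X (-1) (-27) (d i) j).det =
      (Matrix.of fun i j => gradSum w (-1) (-27) (d i) j).det := by
  rw [RingHom.map_det]
  refine congrArg Matrix.det (Matrix.ext fun i j => ?_)
  have h1 : Polynomial.eval₂RingHom (Int.castRingHom S) w (-1) = -1 := by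
    rw [map_neg, map_one]
  have h2 : Polynomial.eval₂RingHom (Int.castRingHom S) w (-27) = -27 := by
    have h := map_intCast (Polynomial.eval₂RingHom (Int.castRingHom S) w) (-27)
    push_cast at h
    exact h
  have h3 : Polynomial.eval₂RingHom (Int.castRingHom S) w Polynomial.X = w :=
    Polynomial.eval₂_X _ _
  rw [RingHom.mapMatrix_apply, Matrix.map_apply, Matrix.of_apply, Matrix.of_apply, map_gradSum]
  rw [h1, h2, h3]

/-- If the determinant over `ℤ[X]` vanished at `ω`, the cyclotomic polynomial `X² + X + 1` would
divide it over `ℤ`. It would then vanish at 6 modulo 43 as well, contrary to the computation. -/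
theorem det_gradSum_ne_zero :
    (Matrix.of fun i j => gradSum omega (-1) (-27) (generatorIndex i) j).det ≠ 0 := by
  intro h0
  have hmap := fun {S : Type} [CommRing S] (w : S) => eval₂_det_gradSum w generatorIndex
  set M : Matrix (Fin 6) (Fin 6) (Polynomial ℤ) :=
    Matrix.of fun i j => gradSum Polynomial.X (-1) (-27) (generatorIndex i) j
  have h1 : Polynomial.aeval omega M.det = 0 := (hmap omega).trans h0
  have h2 : Polynomial.cyclotomic 3 ℤ ∣ M.det := by
    rw [Polynomial.cyclotomic_eq_minpoly omega_isPrimitiveRoot (by norm_num)]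
    exact minpoly.isIntegrallyClosed_dvd (omega_isPrimitiveRoot.isIntegral (by norm_num)) h1
  obtain ⟨q, hq⟩ := h2
  refine det_gradSum_zmod_ne_zero ?_
  rw [← hmap, hq, map_mul, Polynomial.cyclotomic_three]
  have : Polynomial.eval₂RingHom (Int.castRingHom (ZMod 43)) 6
      (Polynomial.X ^ 2 + Polynomial.X + 1) = 0 := by
    simp
    decide
  rw [this, zero_mul]

theorem generatorIndex_pos (i : Fin 6) : 1 ≤ generatorIndex i := by
  revert i
  decide

/-- The Jacobian of the six generators does not vanish. -/
theorem jac_f_ne_zero : jac (fun i => f (generatorIndex i)) ≠ 0 := by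
  intro h0
  have h1 := congrArg (eval fun i => (basePoint i : ℂ)) h0
  rw [jac, RingHom.map_det, map_zero] at h1
  have h2 : (eval fun i => (basePoint i : ℂ)).mapMatrix
      (jacobianMatrix fun i => f (generatorIndex i)) =
      Matrix.of fun i j => (6 * generatorIndex i / 486 : ℂ) *
        (Matrix.of fun i j => gradSum omega (-1) (-27) (generatorIndex i) j) i j := by
    ext i j
    exact eval_pderiv_f _ (generatorIndex_pos i) j
  rw [h2, Matrix.det_mul_column, mul_eq_zero] at h1
  rcases h1 with h1 | h1
  · obtain ⟨i, -, hi⟩ := Finset.prod_eq_zero_iff.1 h1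
    have : (generatorIndex i : ℂ) ≠ 0 := by
      exact_mod_cast Nat.one_le_iff_ne_zero.1 (generatorIndex_pos i)
    simp [this] at hi
  · exact det_gradSum_ne_zero h1

end Nonvanishing

/-! ### Linear forms that divide all Jacobians of invariants. -/

section Reflections

theorem subst_eq_self_of_mem_normals {a : Fin 6 → ℂ} (ha : a ∈ normals)
    {p : MvPolynomial (Fin 6) ℂ} (hp : p ∈ invariantRing G34) :
    subst (reflectionMatrix a) p = p := by
  have h := reflectionMatrix_mul_self (ne_zero_of_mem_normals ha)
  exact subst_eq_self hp (g := ⟨reflectionMatrix a, reflectionMatrix a, h, h⟩)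
    (Subgroup.subset_closure ⟨a, ha, rfl⟩)

theorem star_dotProduct_self_ne_zero {a : Fin 6 → ℂ} (ha : a ≠ 0) : star a ⬝ᵥ a ≠ 0 := by
  open scoped ComplexOrder in
  simpa using ha

theorem det_reflectionMatrix {a : Fin 6 → ℂ} (ha : a ≠ 0) : (reflectionMatrix a).det = -1 := by
  have h := star_dotProduct_self_ne_zero ha
  have h1 : reflectionMatrix a = 1 + Matrix.replicateCol Unit (-(2 / (star a ⬝ᵥ a)) • a) *
      Matrix.replicateRow Unit (star a) := by
    rw [← Matrix.vecMulVec_eq, Matrix.smul_vecMulVec, neg_smul, ← sub_eq_add_neg]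
    rfl
  rw [h1, Matrix.det_one_add_replicateCol_mul_replicateRow, dotProduct_smul, smul_eq_mul]
  field_simp
  norm_num

/-- A reflection fixes its hyperplane pointwise, so the difference vanishes there. Algebraically, it
suffices to check the variables and use a twisted Leibniz rule. -/
theorem linearForm_dvd_sub_subst (a : Fin 6 → ℂ) (p : MvPolynomial (Fin 6) ℂ) :
    linearForm (star a) ∣ p - subst (reflectionMatrix a) p := by
  induction p using MvPolynomial.induction_on with
  | C c => rw [subst_C, sub_self]; exact dvd_zero _
  | add p q hp hq =>
    rw [map_add, add_sub_add_comm]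
    exact dvd_add hp hq
  | mul_X p i hp =>
    have h1 : X i - subst (reflectionMatrix a) (X i) =
        linearForm (star a) * C (2 / (star a ⬝ᵥ a) * a i) := by
      rw [subst_X, linearForm, Finset.sum_mul]
      have : ∀ j, C (reflectionMatrix a i j) * X j = (if i = j then X j else 0) -
          C (star a j) * X j * C (2 / (star a ⬝ᵥ a) * a i) := by
        intro j
        rw [reflectionMatrix, Matrix.sub_apply, Matrix.smul_apply, Matrix.vecMulVec_apply,
          Matrix.one_apply, C_sub, sub_mul, smul_eq_mul]
        congr 1
        · split_ifs <;> simp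
        · rw [Pi.star_apply]
          simp only [C_mul]
          ring
      simp only [this, Finset.sum_sub_distrib, Finset.sum_ite_eq, Finset.mem_univ, if_true]
      ring
    have h2 : p * X i - subst (reflectionMatrix a) (p * X i) =
        (p - subst (reflectionMatrix a) p) * X i +
          subst (reflectionMatrix a) p * (X i - subst (reflectionMatrix a) (X i)) := by
      rw [map_mul]
      ring
    rw [h2, h1]
    exact dvd_add (hp.mul_right _) ((dvd_mul_right _ _).mul_left _)

theorem linearForm_smul (c : ℂ) (v : Fin 6 → ℂ) : linearForm (c • v) = C c * linearForm v := by
  simp only [linearForm, Finset.mul_sum, Pi.smul_apply, smul_eq_mul, C_mul, mul_assoc]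

/-- The coefficient vectors of the linear forms that divide every Jacobian of invariants. -/
def jacobianRoots : Set (Fin 6 → ℂ) :=
  {α | ∀ q : Fin 6 → MvPolynomial (Fin 6) ℂ, (∀ i, q i ∈ invariantRing G34) →
    linearForm α ∣ jac q}

theorem subst_jac {a : Fin 6 → ℂ} (ha : a ∈ normals) {q : Fin 6 → MvPolynomial (Fin 6) ℂ}
    (hq : ∀ i, q i ∈ invariantRing G34) : subst (reflectionMatrix a) (jac q) = -jac q := by
  have h := jac_subst _ q fun i => subst_eq_self_of_mem_normals ha (hq i)
  rw [det_reflectionMatrix (ne_zero_of_mem_normals ha), C_neg, C_1, mul_neg, mul_one] at h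
  rw [eq_neg_iff_add_eq_zero, add_comm, ← eq_neg_iff_add_eq_zero]
  exact h

/-- Since the Jacobian is anti-invariant, its difference with its reflection is twice itself. -/
theorem star_mem_jacobianRoots {a : Fin 6 → ℂ} (ha : a ∈ normals) : star a ∈ jacobianRoots := by
  intro q hq
  have h := linearForm_dvd_sub_subst a (jac q)
  rw [subst_jac ha hq, sub_neg_eq_add, ← two_mul] at h
  have h2 : jac q = C (1 / 2) * (2 * jac q) := by
    rw [← mul_assoc, show (2 : MvPolynomial (Fin 6) ℂ) = C 2 from (map_ofNat C 2).symm, ← C_mul]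
    norm_num
  rw [h2]
  exact h.mul_left _

/-- Reflecting the divisibility changes the Jacobian only by a sign. Stability under the generators
thus spreads the few given normals to all 126 hyperplanes. -/
theorem vecMul_mem_jacobianRoots {a : Fin 6 → ℂ} (ha : a ∈ normals) {α : Fin 6 → ℂ}
    (hα : α ∈ jacobianRoots) : Matrix.vecMul α (reflectionMatrix a) ∈ jacobianRoots := by
  intro q hq
  have h := map_dvd (subst (reflectionMatrix a)) (hα q hq)
  rwa [subst_linearForm, subst_jac ha hq, dvd_neg] at h

theorem comp_swap_mem_jacobianRoots {α : Fin 6 → ℂ} (hα : α ∈ jacobianRoots) {i j : Fin 6}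
    (hij : i ≠ j) : α ∘ Equiv.swap i j ∈ jacobianRoots := by
  rw [← vecMul_reflectionMatrix_sub hij]
  exact vecMul_mem_jacobianRoots (Or.inl ⟨i, j, hij, rfl⟩) hα

theorem comp_perm_mem_jacobianRoots {α : Fin 6 → ℂ} (hα : α ∈ jacobianRoots)
    (σ : Equiv.Perm (Fin 6)) : α ∘ σ ∈ jacobianRoots := by
  induction σ using Equiv.Perm.swap_induction_on' with
  | one => exact hα
  | mul_swap f x y hxy ih => exact comp_swap_mem_jacobianRoots ih hxy

/-- The diagonal of the product of two reflections. -/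
def diagVec (i j : Fin 6) : Fin 6 → ℂ :=
  fun l => if l = i then omega else if l = j then omega ^ 2 else 1

theorem mul_diagVec_mem_jacobianRoots {α : Fin 6 → ℂ} (hα : α ∈ jacobianRoots) {i j : Fin 6}
    (hij : i ≠ j) : α * diagVec i j ∈ jacobianRoots := by
  -- Swapping the first two coordinates and then applying the `ω`-reflection is diagonal;
  -- conjugating by a permutation moves this to any pair.
  have base : ∀ β ∈ jacobianRoots, β * diagVec 1 0 ∈ jacobianRoots := by
    intro β hβ
    have h := vecMul_mem_jacobianRoots (a := star ![1, -omega, 0, 0, 0, 0])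
      (Or.inr (Or.inl rfl)) (comp_swap_mem_jacobianRoots hβ (i := 0) (j := 1) (by decide))
    rw [vecMul_reflectionMatrix_omega] at h
    convert h using 1
    funext l
    fin_cases l <;> simp [diagVec, mul_comm, Equiv.swap_apply_def]
  obtain ⟨σ, h1, h0⟩ : ∃ σ : Equiv.Perm (Fin 6), σ 1 = i ∧ σ 0 = j := by
    refine ⟨Equiv.swap 1 i * Equiv.swap 0 (Equiv.swap 1 i j), ?_, ?_⟩
    · have e : Equiv.swap 0 (Equiv.swap 1 i j) 1 = 1 := by
        refine Equiv.swap_apply_of_ne_of_ne (by decide) fun h => hij ?_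
        have h2 := congrArg (Equiv.swap 1 i) h
        rwa [Equiv.swap_apply_left, Equiv.swap_apply_self] at h2
      rw [Equiv.Perm.mul_apply, e, Equiv.swap_apply_left]
    · rw [Equiv.Perm.mul_apply, Equiv.swap_apply_left, Equiv.swap_apply_self]
  have h := comp_perm_mem_jacobianRoots (base _ (comp_perm_mem_jacobianRoots hα σ)) σ⁻¹
  convert h using 1
  funext l
  have e1 : l = i ↔ σ⁻¹ l = 1 := by rw [Equiv.Perm.inv_eq_iff_eq, h1]
  have e2 : l = j ↔ σ⁻¹ l = 0 := by rw [Equiv.Perm.inv_eq_iff_eq, h0]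
  simp [diagVec, e1, e2]

theorem mul_diagVec_pow_mem_jacobianRoots {α : Fin 6 → ℂ} (hα : α ∈ jacobianRoots) {i j : Fin 6}
    (hij : i ≠ j) (n : ℕ) : α * diagVec i j ^ n ∈ jacobianRoots := by
  induction n with
  | zero => simpa using hα
  | succ n ih =>
    rw [pow_succ, ← mul_assoc]
    exact mul_diagVec_mem_jacobianRoots ih hij

theorem single_sub_single_mem_jacobianRoots {i j : Fin 6} (hij : i ≠ j) (n : ℕ) :
    Pi.single i 1 - Pi.single j (omega ^ n) ∈ jacobianRoots := by
  have h := star_mem_jacobianRoots (Or.inl ⟨i, j, hij, rfl⟩)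
  rw [star_sub, ← Pi.single_star, ← Pi.single_star, star_one] at h
  -- The factor `ω²` that accompanies the twist at `j` is put at `k`, where the vector is zero.
  obtain ⟨k, hi, hj⟩ : ∃ k : Fin 6, k ≠ i ∧ k ≠ j := by
    clear * - i j
    revert i j
    decide
  convert mul_diagVec_pow_mem_jacobianRoots h hj.symm n using 1
  funext l
  by_cases h1 : l = j
  · subst h1
    simp [diagVec, hij.symm]
  · by_cases h2 : l = i
    · subst h2
      simp [diagVec, hij, hi.symm]
    · simp [h1, h2]

theorem omega_pow_mem_jacobianRoots {a : Fin 6 → Fin 3} (ha : ∑ i, (a i : ℕ) ≡ 0 [MOD 3]) :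
    (fun i => omega ^ (a i : ℕ)) ∈ jacobianRoots := by
  have h : star (fun _ => 1 : Fin 6 → ℂ) ∈ jacobianRoots :=
    star_mem_jacobianRoots (Or.inr (Or.inr rfl))
  have h1 := mul_diagVec_pow_mem_jacobianRoots (mul_diagVec_pow_mem_jacobianRoots
    (mul_diagVec_pow_mem_jacobianRoots (mul_diagVec_pow_mem_jacobianRoots
    (mul_diagVec_pow_mem_jacobianRoots h (show (0 : Fin 6) ≠ 5 by decide) (a 0))
    (show (1 : Fin 6) ≠ 5 by decide) (a 1)) (show (2 : Fin 6) ≠ 5 by decide) (a 2))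
    (show (3 : Fin 6) ≠ 5 by decide) (a 3)) (show (4 : Fin 6) ≠ 5 by decide) (a 4)
  convert h1 using 1
  funext l
  fin_cases l
  · simp [diagVec]
  · simp [diagVec]
  · simp [diagVec]
  · simp [diagVec]
  · simp [diagVec]
  · rw [Fin.sum_univ_six] at ha
    -- The twists leave the exponent `2 (a 0 + ⋯ + a 4)` at the last coordinate, which is `a 5`
    -- modulo 3 because `2 ≡ -1` and the total is divisible by 3.
    have e : omega ^ (a 5 : ℕ) = omega ^ (2 * ((a 0 : ℕ) + a 1 + a 2 + a 3 + a 4)) := by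
      rw [← pow_mod_orderOf, ← pow_mod_orderOf (n := 2 * _), ← omega_isPrimitiveRoot.eq_orderOf]
      congr 1
      change _ % 3 = 0 % 3 at ha
      omega
    simp [diagVec]
    rw [e]
    ring

end Reflections

/-! ### The 126 hyperplanes and the degree count. -/

section Roots

theorem totalDegree_linearForm {α : Fin 6 → ℂ} (h : linearForm α ≠ 0) :
    (linearForm α).totalDegree = 1 :=
  (isHomogeneous_linearForm α).totalDegree h

theorem coeff_linearForm (α : Fin 6 → ℂ) (i : Fin 6) :
    coeff (Finsupp.single i 1) (linearForm α) = α i := by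
  simp [linearForm, coeff_sum, coeff_C_mul, coeff_X, Finsupp.single_left_inj]

theorem linearForm_injective : Function.Injective linearForm := fun α β h =>
  funext fun i => by rw [← coeff_linearForm α, h, coeff_linearForm]

theorem linearForm_ne_zero {α : Fin 6 → ℂ} (h : α ≠ 0) : linearForm α ≠ 0 := by
  intro h0
  refine h (linearForm_injective ?_)
  rw [h0]
  simp [linearForm]

theorem irreducible_linearForm {α : Fin 6 → ℂ} (h : α ≠ 0) : Irreducible (linearForm α) := by
  refine irreducible_of_totalDegree_eq_one
    (totalDegree_linearForm (linearForm_ne_zero h)) fun x hx => ?_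
  obtain ⟨i, hi⟩ := Function.ne_iff.1 h
  have h1 := hx (Finsupp.single i 1)
  rw [coeff_linearForm] at h1
  refine IsUnit.mk0 _ ?_
  rintro rfl
  exact hi (zero_dvd_iff.1 h1)

/-- Linear forms that divide each other are proportional. -/
theorem exists_smul_of_linearForm_dvd {α β : Fin 6 → ℂ} (hα : α ≠ 0) (hβ : β ≠ 0)
    (h : linearForm α ∣ linearForm β) : ∃ c : ℂ, β = c • α := by
  obtain ⟨r, hr⟩ := h
  have hr0 : r ≠ 0 := by
    rintro rfl
    rw [mul_zero] at hr
    exact linearForm_ne_zero hβ hr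
  have hd := congrArg totalDegree hr
  rw [totalDegree_mul_of_isDomain (linearForm_ne_zero hα) hr0,
    totalDegree_linearForm (linearForm_ne_zero hα),
    totalDegree_linearForm (linearForm_ne_zero hβ)] at hd
  rw [totalDegree_eq_zero_iff_eq_C.1 (by omega : r.totalDegree = 0)] at hr
  refine ⟨coeff 0 r, linearForm_injective ?_⟩
  rw [linearForm_smul, mul_comm, hr]

/-- The parameters of the linear forms `x_i - ω^c x_j` with `i < j`. -/
abbrev PairIndex := {t : Fin 6 × Fin 6 × Fin 3 // t.1 < t.2.1}

/-- The parameters of the linear forms `∑ ω^(a_i) x_i` with `a_1 = 0` and `3 ∣ ∑ a_i`. -/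
abbrev FullIndex := {a : Fin 6 → Fin 3 // a 0 = 0 ∧ (∑ i, (a i : ℕ)) ≡ 0 [MOD 3]}

/-- The normalized coefficient vectors of the 126 reflecting hyperplanes. -/
def root : PairIndex ⊕ FullIndex → Fin 6 → ℂ
  | .inl t => Pi.single t.1.1 1 - Pi.single t.1.2.1 (omega ^ (t.1.2.2 : ℕ))
  | .inr a => fun i => omega ^ (a.1 i : ℕ)

/-- There are `15 · 3` forms in two variables and `3^4` in six; the first and last exponents of the
latter are determined by the normalisation and the sum. -/
theorem card_index : Fintype.card (PairIndex ⊕ FullIndex) = 126 := by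
  have h1 : Fintype.card PairIndex = 45 := by decide +kernel
  have h2 : Fintype.card FullIndex = 81 := by decide +kernel
  rw [Fintype.card_sum, h1, h2]

theorem root_mem_jacobianRoots (t : PairIndex ⊕ FullIndex) : root t ∈ jacobianRoots := by
  rcases t with t | a
  · exact single_sub_single_mem_jacobianRoots t.2.ne _
  · exact omega_pow_mem_jacobianRoots a.2.2

theorem root_ne_zero (t : PairIndex ⊕ FullIndex) : root t ≠ 0 := by
  rcases t with ⟨⟨i, j, c⟩, h⟩ | a
  · intro h0
    have := congrFun h0 i
    have hij : i ≠ j := h.ne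
    simp [root, hij] at this
  · intro h0
    exact omega_pow_ne_zero _ (congrFun h0 0)

theorem exists_root_inl_eq_zero (t : PairIndex) : ∃ k, root (.inl t) k = 0 := by
  obtain ⟨⟨i, j, c⟩, h⟩ := t
  obtain ⟨k, hi, hj⟩ : ∃ k : Fin 6, k ≠ i ∧ k ≠ j := by
    clear * - i j
    revert i j
    decide
  exact ⟨k, by simp [root, hi, hj]⟩

/-- Supports separate the two families; within each, the first nonzero coefficient is 1, so the
scalar is 1 and the remaining coefficients determine the parameters. -/
theorem root_eq_of_smul {s t : PairIndex ⊕ FullIndex} {c : ℂ} (h : root s = c • root t) :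
    s = t := by
  have hc : c ≠ 0 := by
    rintro rfl
    rw [zero_smul] at h
    exact root_ne_zero s h
  rcases s with s | a <;> rcases t with t | b
  · obtain ⟨⟨i, j, x⟩, hs⟩ := s
    obtain ⟨⟨i', j', x'⟩, ht⟩ := t
    have hij : i < j := hs
    have hij' : i' < j' := ht
    have hsupp : ∀ l, l ≠ i' → l ≠ j' → root (.inl ⟨⟨i, j, x⟩, hs⟩) l = 0 := by
      intro l h1 h2
      rw [h]
      simp [root, h1, h2]
    have hi : i = i' ∨ i = j' := by
      by_contra! hne
      have := hsupp i hne.1 hne.2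
      simp [root, hij.ne] at this
    have hj : j = i' ∨ j = j' := by
      by_contra! hne
      have := hsupp j hne.1 hne.2
      simp [root, hij.ne', omega_ne_zero] at this
    obtain ⟨rfl, rfl⟩ : i = i' ∧ j = j' := by omega
    have e1 := congrFun h i
    have e2 := congrFun h j
    simp [root, hij.ne] at e1
    simp [root, hij.ne', ← e1] at e2
    rw [omega_pow_injective e2]
  · obtain ⟨k, hk⟩ := exists_root_inl_eq_zero s
    rw [h] at hk
    exact absurd hk (mul_ne_zero hc (omega_pow_ne_zero _))
  · obtain ⟨k, hk⟩ := exists_root_inl_eq_zero t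
    have := congrFun h k
    rw [Pi.smul_apply, hk, smul_zero] at this
    exact absurd this (omega_pow_ne_zero _)
  · have e1 := congrFun h 0
    simp [root, a.2.1, b.2.1] at e1
    refine congrArg Sum.inr (Subtype.ext (funext fun i => omega_pow_injective ?_))
    have e2 := congrFun h i
    rwa [← e1, one_smul] at e2

/-- Linear forms are irreducible, so pairwise non-proportional ones are coprime and their product
divides whatever each divides. -/
theorem prod_root_dvd_jac {q : Fin 6 → MvPolynomial (Fin 6) ℂ}
    (hq : ∀ i, q i ∈ invariantRing G34) : ∏ t, linearForm (root t) ∣ jac q := by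
  refine Fintype.prod_dvd_of_isRelPrime (fun s t hst => ?_)
    fun t => root_mem_jacobianRoots t q hq
  refine (irreducible_linearForm (root_ne_zero s)).isRelPrime_iff_not_dvd.2 fun h => hst ?_
  obtain ⟨c, hc⟩ := exists_smul_of_linearForm_dvd (root_ne_zero s) (root_ne_zero t) h
  exact (root_eq_of_smul hc).symm

theorem f_mem_invariantRing {k : ℕ} (hk : 1 ≤ k) : f k ∈ invariantRing G34 := by
  rw [f_eq_smul_powerSum k hk]
  exact Subalgebra.smul_mem _ (powerSum_mem_invariantRing _) _

theorem isHomogeneous_f {k : ℕ} (hk : 1 ≤ k) : (f k).IsHomogeneous (6 * k) := by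
  rw [f_eq_smul_powerSum k hk, smul_eq_C_mul]
  exact (isHomogeneous_powerSum _).C_mul _

/-- The Jacobian of the generators is a constant multiple of the product of the linear forms of
the 126 reflecting hyperplanes, so it divides the Jacobian of any six invariants. -/
theorem jac_f_dvd {q : Fin 6 → MvPolynomial (Fin 6) ℂ} (hq : ∀ i, q i ∈ invariantRing G34) :
    jac (fun i => f (generatorIndex i)) ∣ jac q := by
  obtain ⟨r, hr⟩ := prod_root_dvd_jac fun i => f_mem_invariantRing (generatorIndex_pos i)
  have hJ := jac_f_ne_zero
  have hP0 : ∏ t, linearForm (root t) ≠ 0 := fun h => hJ (by rw [hr, h, zero_mul])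
  have hr0 : r ≠ 0 := fun h => hJ (by rw [hr, h, mul_zero])
  have hP : (∏ t, linearForm (root t)).totalDegree = 126 := by
    have := IsHomogeneous.prod Finset.univ (fun t => linearForm (root t)) (fun _ => 1)
      fun t _ => isHomogeneous_linearForm (root t)
    rw [Finset.sum_const, Finset.card_univ, card_index] at this
    exact this.totalDegree hP0
  -- The degrees of the rows add up to `5 + 11 + 17 + 23 + 29 + 41 = 126`, the number of
  -- hyperplanes, so the cofactor `r` is constant.
  have hd : (jac fun i => f (generatorIndex i)).totalDegree = 126 := by
    have h1 := isHomogeneous_det (jacobianMatrix fun i => f (generatorIndex i))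
      (fun i => 6 * generatorIndex i - 1)
      fun i j => (isHomogeneous_f (generatorIndex_pos i)).pderiv
    exact h1.totalDegree hJ
  rw [hr, totalDegree_mul_of_isDomain hP0 hr0, hP] at hd
  rw [totalDegree_eq_zero_iff_eq_C.1 (by omega : r.totalDegree = 0)] at hr hr0
  rw [hr]
  refine ((associated_mul_unit_right _ _ ?_).symm.dvd).trans (prod_root_dvd_jac hq)
  exact (IsUnit.mk0 _ fun h => hr0 (by rw [h, C_0])).map C

end Roots

end Mitchell

end

theorem mainTheorem10 :
    -- `f_6, f_12, f_18, f_24, f_30, f_42` are polynomial generators of the invariant ring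
    (AlgebraicIndependent ℂ (fun i : Fin 6 => Mitchell.f (![1, 2, 3, 4, 5, 7] i)) ∧
      Algebra.adjoin ℂ (Set.range fun i : Fin 6 => Mitchell.f (![1, 2, 3, 4, 5, 7] i)) =
        Mitchell.invariantRing Mitchell.G34) ∧
    -- the 756 vectors are the minimal vectors of the lattice that they span
    (Mitchell.vectors.card = 756 ∧
      (∀ v : Fin 6 → ℂ, v ∈ Mitchell.vectors ↔
        v ∈ Mitchell.lattice ∧ ∑ i, ‖v i‖ ^ 2 = 2) ∧
      (∀ v ∈ Mitchell.lattice, v ≠ 0 → 2 ≤ ∑ i, ‖v i‖ ^ 2)) ∧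
    -- the closed formula is a multiple of the power sum over these vectors
    (∀ k : ℕ, 1 ≤ k →
      Mitchell.f k = ((-27 : ℂ) ^ k / 486) • Mitchell.powerSum (6 * k)) :=
  ⟨⟨Mitchell.algebraicIndependent_of_jac_ne_zero _ Mitchell.jac_f_ne_zero,
    Mitchell.adjoin_eq_invariantRing
      (fun i => Nat.mul_pos (by norm_num) (Mitchell.generatorIndex_pos i))
      (fun i => Mitchell.f_mem_invariantRing (Mitchell.generatorIndex_pos i))
      (fun i => Mitchell.isHomogeneous_f (Mitchell.generatorIndex_pos i))
      Mitchell.jac_f_ne_zero fun _ hq => Mitchell.jac_f_dvd hq⟩,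
    ⟨Mitchell.card_vectors, fun _ => Mitchell.mem_vectors_iff_mem_lattice,
      fun _ => Mitchell.two_le_sum_norm_sq⟩, Mitchell.f_eq_smul_powerSum⟩
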